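/- Let $D\ge 1$, let $S_1,S_2\subseteq\{0,1,\dots,D-1\}$ be sets with $f_1=|S_1|$, $f_2=|S_2|$, $a=|S_1\cap S_2|$, and assume $0<a<\min(f_1,f_2)$. Let $\pi_1,\pi_2,\dots$ be independent, uniformly distributed random permutations of $\{0,\dots,D-1\}$. For $k\ge 1$ let $k_=$, $k_<$ and $k_>$ be the numbers of indices $j\in\{1,\dots,k\}$ for which $\min \pi_j(S_1)$ is, respectively, equal to, less than, and greater than $\min\pi_j(S_2)$. Then: (0) $(k_=,k_<,k_>)$ has the multinomial distribution with $k$ trials and the cell probabilities $P_=(a),P_<(a),P_>(a)$, where $$P_=(t)=\frac{t}{f_1+f_2-t},\qquad P_<(t)=\frac{f_1-t}{f_1+f_2-t},\qquad P_>(t)=\frac{f_2-t}{f_1+f_2-t}.$$ Let the maximum likelihood estimator $\hat a_{MLE}$ be a maximizer over the real parameter $t\in[0,\min(f_1,f_2)]$ of the multinomial likelihood $$L(t)=\frac{k!}{k_=!\,k_<!\,k_>!}\,P_=(t)^{k_=}P_<(t)^{k_<}P_>(t)^{k_>}\qquad(\text{with }0^0=1).$$ (1) For all nonnegative integer values of the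 counts with $k=k_=+k_<+k_>\ge 1$ there is exactly one maximizer. A point $t\in(0,\min(f_1,f_2))$ is the maximizer if and only if $$k_=\frac{f_1+f_2}{t}-k_<\frac{f_2}{f_1-t}-k_>\frac{f_1}{f_2-t}=0 .$$ If $k_=,k_<,k_>$ are all positive, this equation has exactly one solution $t$ in $(0,\min(f_1,f_2))$, and $\hat a_{MLE}$ is that solution. The probability that all three counts are positive tends to $1$ as $k\to\infty$. (2) For each $k\ge1$, $\hat a_{MLE}$ has a finite second moment, and it is asymptotically unbiased: $E(\hat a_{MLE})\to a$ as $k\to\infty$. (3) As $k\to\infty$, with $S_1$ and $S_2$ fixed, $$Var(\hat a_{MLE})=\frac1k\,\frac{(f_1+f_2-a)^2}{\frac{f_1+f_2}{a}+\frac{f_2}{f_1-a}+\frac{f_1}{f_2-a}}+O\!\left(\frac1{k^2}\right).$$ -/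

import Mathlib

open MeasureTheory ProbabilityTheory Filter Topology Asymptotics
open scoped Nat

/-- The minimum hashed value `min (σ(S))` of the set `S ⊆ {0, …, D-1}` under the permutation `σ`
(an ordinary element of `{0, …, D-1}` whenever `S` is nonempty). -/
def minHash {D : ℕ} (σ : Equiv.Perm (Fin D)) (S : Finset (Fin D)) : WithTop (Fin D) :=
  (S.image σ).min

/-- `k_=`: how many of the first `k` permutations give equal minima. -/
def countEq {D : ℕ} (S₁ S₂ : Finset (Fin D)) (k : ℕ) (p : ℕ → Equiv.Perm (Fin D)) : ℕ :=
  ((Finset.range k).filter (fun j => minHash (p j) S₁ = minHash (p j) S₂)).card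

/-- `k_<`: how many of the first `k` permutations give a smaller minimum on `S₁`. -/
def countLt {D : ℕ} (S₁ S₂ : Finset (Fin D)) (k : ℕ) (p : ℕ → Equiv.Perm (Fin D)) : ℕ :=
  ((Finset.range k).filter (fun j => minHash (p j) S₁ < minHash (p j) S₂)).card

/-- `k_>`: how many of the first `k` permutations give a larger minimum on `S₁`. -/
def countGt {D : ℕ} (S₁ S₂ : Finset (Fin D)) (k : ℕ) (p : ℕ → Equiv.Perm (Fin D)) : ℕ :=
  ((Finset.range k).filter (fun j => minHash (p j) S₂ < minHash (p j) S₁)).card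

/-- Cell probability `P_=` as a function of the intersection size `t`. -/
noncomputable def cellEq (f₁ f₂ t : ℝ) : ℝ := t / (f₁ + f₂ - t)

/-- Cell probability `P_<` as a function of the intersection size `t`. -/
noncomputable def cellLt (f₁ f₂ t : ℝ) : ℝ := (f₁ - t) / (f₁ + f₂ - t)

/-- Cell probability `P_>` as a function of the intersection size `t`. -/
noncomputable def cellGt (f₁ f₂ t : ℝ) : ℝ := (f₂ - t) / (f₁ + f₂ - t)

/-- The likelihood of the counts `(kEq, kLt, kGt)` in the 3-cell multinomial model with
intersection size `t`: the multinomial probability of these counts. -/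
noncomputable def likelihood (f₁ f₂ : ℝ) (kEq kLt kGt : ℕ) (t : ℝ) : ℝ :=
  (((kEq + kLt + kGt)! : ℝ) / ((kEq ! : ℝ) * (kLt ! : ℝ) * (kGt ! : ℝ))) *
    (cellEq f₁ f₂ t ^ kEq * cellLt f₁ f₂ t ^ kLt * cellGt f₁ f₂ t ^ kGt)

/-- `t` is a maximum likelihood estimate of the intersection size, viewed as a real parameter in
`[0, min f₁ f₂]` (the set on which the three cell probabilities are nonnegative). -/
def IsMLE (f₁ f₂ : ℝ) (kEq kLt kGt : ℕ) (t : ℝ) : Prop :=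
  t ∈ Set.Icc 0 (min f₁ f₂) ∧ IsMaxOn (likelihood f₁ f₂ kEq kLt kGt) (Set.Icc 0 (min f₁ f₂)) t

/-- The likelihood equation
`k_= (f₁ + f₂) / t - k_< f₂ / (f₁ - t) - k_> f₁ / (f₂ - t) = 0`. -/
def MLEEquation (f₁ f₂ : ℝ) (kEq kLt kGt : ℕ) (t : ℝ) : Prop :=
  (kEq : ℝ) * ((f₁ + f₂) / t) - (kLt : ℝ) * (f₂ / (f₁ - t)) - (kGt : ℝ) * (f₁ / (f₂ - t)) = 0

/-! Write F = f₁ + f₂. The element of S₁ ∪ S₂ with the smallest image is uniform on the union, and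
its membership in S₁ ∩ S₂, S₁ \ S₂ or S₂ \ S₁ decides the comparison of the minima. So each
permutation is one trial with the stated cell probabilities, and expectations over the counts become
`trinomialExp`.

The cell probabilities are affine in 1/(F - t), so the log-likelihood is strictly concave in that
parameter. Here this is used in midpoint form (`IsMLE.unique`) and in tangent form
(`isMLE_of_mleEquation`), neither of which needs logarithms of possibly vanishing cells.

For the moments, let h be the estimation error and N the total deviation of the cell frequencies.
With no empty cell, the likelihood equation is exactly B h = u + h v + c h² + h² w, with u, v, w
linear in the deviations and u the score at a. An empty cell forces N to be bounded below, so the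
bounded discrepancy in that case is of every order in N. Since h = O(N), inversion gives B h = u +
O(N²) and B² h² = u² + (cubic form) + O(N⁴); see `mle_error_expansion`.

The score has mean zero and E N² = O(1/k), so the bias is O(1/k). The variance of u is
`scoreSlope`/k, and E N⁴ = O(1/k²). Third moments of centred sums grow only like k, so the cubic
terms also contribute O(1/k²), rather than the k^(-3/2) that their size suggests. Subtracting the
squared bias yields the variance. -/

/-! ### Existence, uniqueness and characterization of the maximizer. -/

section Likelihood

variable {f₁ f₂ : ℝ} {kEq kLt kGt : ℕ} {t : ℝ}

lemma cell_nonneg (ht : t ∈ Set.Icc 0 (min f₁ f₂)) :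
    0 ≤ cellEq f₁ f₂ t ∧ 0 ≤ cellLt f₁ f₂ t ∧ 0 ≤ cellGt f₁ f₂ t := by
  obtain ⟨h0, hm⟩ := ht
  have := hm.trans (min_le_left _ _)
  have := hm.trans (min_le_right _ _)
  refine ⟨div_nonneg ?_ ?_, div_nonneg ?_ ?_, div_nonneg ?_ ?_⟩ <;> linarith

lemma cell_pos (ht : t ∈ Set.Ioo 0 (min f₁ f₂)) :
    0 < cellEq f₁ f₂ t ∧ 0 < cellLt f₁ f₂ t ∧ 0 < cellGt f₁ f₂ t := by
  obtain ⟨h0, hm⟩ := ht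
  have := hm.trans_le (min_le_left _ _)
  have := hm.trans_le (min_le_right _ _)
  refine ⟨div_pos ?_ ?_, div_pos ?_ ?_, div_pos ?_ ?_⟩ <;> linarith

lemma cell_sum (ht : f₁ + f₂ - t ≠ 0) :
    cellEq f₁ f₂ t + cellLt f₁ f₂ t + cellGt f₁ f₂ t = 1 := by
  unfold cellEq cellLt cellGt
  field_simp
  ring

lemma multinomial_coeff_pos :
    0 < (((kEq + kLt + kGt)! : ℝ) / ((kEq ! : ℝ) * (kLt ! : ℝ) * (kGt ! : ℝ))) := by
  positivity

lemma likelihood_pos (ht : t ∈ Set.Ioo 0 (min f₁ f₂)) :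
    0 < likelihood f₁ f₂ kEq kLt kGt t := by
  obtain ⟨e, l, g⟩ := cell_pos ht
  unfold likelihood
  positivity

/-- A maximizer, even on the boundary, does at least as well as the midpoint of the interval.
Positivity is what makes the later inequalities strict. -/
lemma IsMLE.likelihood_pos (h₁ : 0 < f₁) (h₂ : 0 < f₂) (h : IsMLE f₁ f₂ kEq kLt kGt t) :
    0 < likelihood f₁ f₂ kEq kLt kGt t := by
  have hm : 0 < min f₁ f₂ := lt_min h₁ h₂
  have hmem : min f₁ f₂ / 2 ∈ Set.Ioo 0 (min f₁ f₂) := ⟨by linarith, by linarith⟩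
  exact (_root_.likelihood_pos hmem).trans_le (h.2 (Set.Ioo_subset_Icc_self hmem))

lemma exists_isMLE (h₁ : 0 < f₁) (h₂ : 0 < f₂) (kEq kLt kGt : ℕ) :
    ∃ t, IsMLE f₁ f₂ kEq kLt kGt t := by
  have hm : 0 < min f₁ f₂ := lt_min h₁ h₂
  have hne : ∀ t ∈ Set.Icc 0 (min f₁ f₂), f₁ + f₂ - t ≠ 0 := fun t ht => by
    have := ht.2.trans (min_le_left _ _)
    linarith
  have hc : ContinuousOn (likelihood f₁ f₂ kEq kLt kGt) (Set.Icc 0 (min f₁ f₂)) := by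
    unfold likelihood cellEq cellLt cellGt
    fun_prop (disch := assumption)
  obtain ⟨t, ht, hmax⟩ := isCompact_Icc.exists_isMaxOn ⟨0, le_rfl, hm.le⟩ hc
  exact ⟨t, ht, hmax⟩

/-- The cell probabilities are affine in `1 / (f₁ + f₂ - t)`, so the average of two points of the
model belongs to the model. -/
lemma exists_cell_average (h₂ : 0 < f₂) {t u : ℝ}
    (ht : t ∈ Set.Icc 0 (min f₁ f₂)) (hu : u ∈ Set.Icc 0 (min f₁ f₂)) :
    ∃ v ∈ Set.Icc 0 (min f₁ f₂),
      cellEq f₁ f₂ v = (cellEq f₁ f₂ t + cellEq f₁ f₂ u) / 2 ∧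
      cellLt f₁ f₂ v = (cellLt f₁ f₂ t + cellLt f₁ f₂ u) / 2 ∧
      cellGt f₁ f₂ v = (cellGt f₁ f₂ t + cellGt f₁ f₂ u) / 2 := by
  obtain ⟨ht0, htm⟩ := ht
  obtain ⟨hu0, hum⟩ := hu
  have t1 := htm.trans (min_le_left _ _)
  have t2 := htm.trans (min_le_right _ _)
  have u1 := hum.trans (min_le_left _ _)
  have u2 := hum.trans (min_le_right _ _)
  obtain ⟨x, hx⟩ : ∃ x, x = f₁ + f₂ - t := ⟨_, rfl⟩
  obtain ⟨y, hy⟩ : ∃ y, y = f₁ + f₂ - u := ⟨_, rfl⟩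
  have hx0 : 0 < x := by linarith
  have hy0 : 0 < y := by linarith
  have hxy : 0 < x + y := by linarith
  -- Averaging 1/x and 1/y replaces the denominator by the harmonic mean of x and y; `key` and
  -- `key'` say that it stays in the range of admissible denominators.
  have key : ∀ c : ℝ, c ≤ x → c ≤ y → c ≤ 2 * x * y / (x + y) := fun c hcx hcy => by
    rw [le_div_iff₀ hxy]
    nlinarith [mul_nonneg hx0.le (sub_nonneg.2 hcy), mul_nonneg hy0.le (sub_nonneg.2 hcx)]
  have key' : 2 * x * y / (x + y) ≤ f₁ + f₂ := by
    rw [div_le_iff₀ hxy]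
    nlinarith [mul_nonneg hx0.le (sub_nonneg.2 (by linarith : y ≤ f₁ + f₂)),
      mul_nonneg hy0.le (sub_nonneg.2 (by linarith : x ≤ f₁ + f₂))]
  have hv : f₁ + f₂ - (f₁ + f₂ - 2 * x * y / (x + y)) = 2 * x * y / (x + y) := by ring
  refine ⟨f₁ + f₂ - 2 * x * y / (x + y), ⟨by linarith, le_min ?_ ?_⟩, ?_, ?_, ?_⟩
  · linarith [key f₂ (by linarith) (by linarith)]
  · linarith [key f₁ (by linarith) (by linarith)]
  all_goals
    simp only [cellEq, cellLt, cellGt]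
    rw [hv, ← hx, ← hy]
    obtain rfl : t = f₁ + f₂ - x := by linarith
    obtain rfl : u = f₁ + f₂ - y := by linarith
    field_simp
    ring

lemma mul_lt_average_sq {x y : ℝ} (h : x ≠ y) : x * y < ((x + y) / 2) ^ 2 := by
  have : 0 < (x - y) ^ 2 := by
    have := sub_ne_zero.2 h
    positivity
  linarith [this, (by ring : ((x + y) / 2) ^ 2 = x * y + (x - y) ^ 2 / 4)]

lemma mul_pow_le_average_pow {x y : ℝ} (hx : 0 ≤ x) (hy : 0 ≤ y) (n : ℕ) :
    x ^ n * y ^ n ≤ (((x + y) / 2) ^ n) ^ 2 := by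
  rw [← mul_pow, ← pow_mul, mul_comm n 2, pow_mul]
  exact pow_le_pow_left₀ (mul_nonneg hx hy) (by nlinarith [sq_nonneg (x - y)]) n

lemma mul_pow_lt_average_pow {x y : ℝ} (hx : 0 ≤ x) (hy : 0 ≤ y) (h : x ≠ y) {n : ℕ} (hn : 0 < n) :
    x ^ n * y ^ n < (((x + y) / 2) ^ n) ^ 2 := by
  rw [← mul_pow, ← pow_mul, mul_comm n 2, pow_mul]
  exact pow_lt_pow_left₀ (mul_lt_average_sq h) (mul_nonneg hx hy) hn.ne'

lemma mul_mul_lt_mul_mul {a b c x y z : ℝ} (ha : 0 < a) (hb : 0 < b) (hc : 0 < c)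
    (hax : a ≤ x) (hby : b ≤ y) (hcz : c ≤ z) (h : a < x ∨ b < y ∨ c < z) :
    a * b * c < x * y * z := by
  have hx := ha.trans_le hax
  have hy := hb.trans_le hby
  have hz := hc.trans_le hcz
  have h1 : a * b ≤ x * y := by gcongr
  rcases h with h | h | h
  · exact mul_lt_mul (mul_lt_mul h hby hb hx.le) hcz hc (by positivity)
  · exact mul_lt_mul (mul_lt_mul' hax h hb.le hx) hcz hc (by positivity)
  · exact mul_lt_mul' h1 h hc.le (by positivity)

/-- After cross-multiplication the three equalities reduce to t = u multiplied by f₁ + f₂, f₂ and f₁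
respectively. -/
lemma cell_injOn (h₁ : 0 < f₁) (h₂ : 0 < f₂) {t u : ℝ}
    (ht : t ∈ Set.Icc 0 (min f₁ f₂)) (hu : u ∈ Set.Icc 0 (min f₁ f₂)) (htu : t ≠ u) :
    cellEq f₁ f₂ t ≠ cellEq f₁ f₂ u ∧ cellLt f₁ f₂ t ≠ cellLt f₁ f₂ u ∧
      cellGt f₁ f₂ t ≠ cellGt f₁ f₂ u := by
  have t1 := ht.2.trans (min_le_left _ _)
  have u1 := hu.2.trans (min_le_left _ _)
  have hx : f₁ + f₂ - t ≠ 0 := by linarith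
  have hy : f₁ + f₂ - u ≠ 0 := by linarith
  have h0 : f₁ + f₂ ≠ 0 := by linarith
  simp only [cellEq, cellLt, cellGt, ne_eq, div_eq_div_iff hx hy]
  refine ⟨fun h => htu (mul_left_cancel₀ h0 ?_), fun h => htu (mul_left_cancel₀ h₂.ne' ?_),
    fun h => htu (mul_left_cancel₀ h₁.ne' ?_)⟩ <;> linarith

/-- If two maximizers differed, the AM-GM inequality in each cell would give L(v)² > L(t) L(u) at
their cell average v. One positive count suffices for strictness, because all three cells separate
distinct parameters. -/
lemma IsMLE.unique (h₁ : 0 < f₁) (h₂ : 0 < f₂) (hk : 0 < kEq + kLt + kGt) {t u : ℝ}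
    (ht : IsMLE f₁ f₂ kEq kLt kGt t) (hu : IsMLE f₁ f₂ kEq kLt kGt u) : t = u := by
  by_contra htu
  obtain ⟨v, hv, ve, vl, vg⟩ := exists_cell_average h₂ ht.1 hu.1
  obtain ⟨te, tl, tg⟩ := cell_nonneg ht.1
  obtain ⟨ue, ul, ug⟩ := cell_nonneg hu.1
  obtain ⟨ne, nl, ng⟩ := cell_injOn h₁ h₂ ht.1 hu.1 htu
  have tpos := ht.likelihood_pos h₁ h₂
  have upos := hu.likelihood_pos h₁ h₂
  have hv1 := ht.2 hv
  have hv2 := hu.2 hv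
  simp only [Set.mem_ofPred_eq] at hv1 hv2
  have hv0 : 0 ≤ likelihood f₁ f₂ kEq kLt kGt v := by
    obtain ⟨e, l, g⟩ := cell_nonneg hv
    unfold likelihood
    positivity
  have hle : likelihood f₁ f₂ kEq kLt kGt v ^ 2 ≤
      likelihood f₁ f₂ kEq kLt kGt t * likelihood f₁ f₂ kEq kLt kGt u := by
    rw [sq]
    exact mul_le_mul hv1 hv2 hv0 tpos.le
  refine hle.not_gt ?_
  unfold likelihood at tpos upos ⊢
  rw [ve, vl, vg]
  have hC := multinomial_coeff_pos (kEq := kEq) (kLt := kLt) (kGt := kGt)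
  set C := (((kEq + kLt + kGt)! : ℝ) / ((kEq ! : ℝ) * (kLt ! : ℝ) * (kGt ! : ℝ)))
  have tpos' := pos_of_mul_pos_right tpos hC.le
  have upos' := pos_of_mul_pos_right upos hC.le
  have pos3 : ∀ {a b c : ℝ}, 0 ≤ a → 0 ≤ b → 0 ≤ c → 0 < a * b * c → 0 < a ∧ 0 < b ∧ 0 < c :=
    fun {a b c} ha hb hc h =>
      ⟨ha.lt_of_ne fun h0 => by simp [← h0] at h, hb.lt_of_ne fun h0 => by simp [← h0] at h,
        hc.lt_of_ne fun h0 => by simp [← h0] at h⟩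
  obtain ⟨p1, p2, p3⟩ := pos3 (pow_nonneg te kEq) (pow_nonneg tl kLt) (pow_nonneg tg kGt) tpos'
  obtain ⟨q1, q2, q3⟩ := pos3 (pow_nonneg ue kEq) (pow_nonneg ul kLt) (pow_nonneg ug kGt) upos'
  have hpos : 0 < kEq ∨ 0 < kLt ∨ 0 < kGt := by omega
  have := mul_mul_lt_mul_mul (mul_pos p1 q1) (mul_pos p2 q2) (mul_pos p3 q3)
    (mul_pow_le_average_pow te ue kEq) (mul_pow_le_average_pow tl ul kLt)
    (mul_pow_le_average_pow tg ug kGt)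
    (hpos.imp (mul_pow_lt_average_pow te ue ne)
      (Or.imp (mul_pow_lt_average_pow tl ul nl) (mul_pow_lt_average_pow tg ug ng)))
  calc _ = C ^ 2 * (cellEq f₁ f₂ t ^ kEq * cellEq f₁ f₂ u ^ kEq *
        (cellLt f₁ f₂ t ^ kLt * cellLt f₁ f₂ u ^ kLt) *
        (cellGt f₁ f₂ t ^ kGt * cellGt f₁ f₂ u ^ kGt)) := by ring
    _ < _ := mul_lt_mul_of_pos_left this (by positivity)
    _ = _ := by ring

/-- This is the tangent-line bound for n log x at y in exponentiated form, which keeps it valid at x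
= 0. -/
lemma pow_le_pow_mul_exp {x y : ℝ} (hx : 0 ≤ x) (hy : 0 < y) (n : ℕ) :
    x ^ n ≤ y ^ n * Real.exp (n * (x / y - 1)) := by
  rw [Real.exp_nat_mul, ← mul_pow]
  refine pow_le_pow_left₀ hx ?_ n
  have := Real.add_one_le_exp (x / y - 1)
  calc x = y * (x / y - 1 + 1) := by field_simp; ring
    _ ≤ _ := mul_le_mul_of_nonneg_left this hy.le

/-- Multiplying the tangent bounds of the three cells gives L(u) ≤ L(t) exp(s), where s is (u -
t)/(f₁ + f₂ - u) times the left side of the likelihood equation, hence zero. The bound is global, so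
no second-order or boundary analysis is needed. -/
lemma isMLE_of_mleEquation (ht : t ∈ Set.Ioo 0 (min f₁ f₂))
    (h : MLEEquation f₁ f₂ kEq kLt kGt t) : IsMLE f₁ f₂ kEq kLt kGt t := by
  refine ⟨Set.Ioo_subset_Icc_self ht, fun u hu => ?_⟩
  obtain ⟨te, tl, tg⟩ := cell_pos ht
  obtain ⟨ue, ul, ug⟩ := cell_nonneg hu
  have hs : kEq * (cellEq f₁ f₂ u / cellEq f₁ f₂ t - 1) +
      kLt * (cellLt f₁ f₂ u / cellLt f₁ f₂ t - 1) +
      kGt * (cellGt f₁ f₂ u / cellGt f₁ f₂ t - 1) = 0 := by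
    have t0 := ht.1
    have t1 := ht.2.trans_le (min_le_left _ _)
    have t2 := ht.2.trans_le (min_le_right _ _)
    have u1 := hu.2.trans (min_le_left _ _)
    have hx : f₁ + f₂ - t ≠ 0 := by linarith
    have hy : f₁ + f₂ - u ≠ 0 := by linarith
    have e1 : f₁ - t ≠ 0 := by linarith
    have e2 : f₂ - t ≠ 0 := by linarith
    have d1 : cellEq f₁ f₂ u / cellEq f₁ f₂ t - 1 =
        (u - t) / (f₁ + f₂ - u) * ((f₁ + f₂) / t) := by
      unfold cellEq; field_simp; ring
    have d2 : cellLt f₁ f₂ u / cellLt f₁ f₂ t - 1 =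
        -((u - t) / (f₁ + f₂ - u) * (f₂ / (f₁ - t))) := by
      unfold cellLt; field_simp; ring
    have d3 : cellGt f₁ f₂ u / cellGt f₁ f₂ t - 1 =
        -((u - t) / (f₁ + f₂ - u) * (f₁ / (f₂ - t))) := by
      unfold cellGt; field_simp; ring
    unfold MLEEquation at h
    rw [d1, d2, d3]
    linear_combination ((u - t) / (f₁ + f₂ - u)) * h
  simp only [Set.mem_ofPred_eq]
  unfold likelihood
  refine mul_le_mul_of_nonneg_left ?_ multinomial_coeff_pos.le
  have b1 := pow_le_pow_mul_exp ue te kEq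
  have b2 := pow_le_pow_mul_exp ul tl kLt
  have b3 := pow_le_pow_mul_exp ug tg kGt
  have hexp := congrArg Real.exp hs
  rw [Real.exp_add, Real.exp_add, Real.exp_zero] at hexp
  refine (mul_le_mul (mul_le_mul b1 b2 (by positivity) (by positivity)) b3 (by positivity)
    (by positivity)).trans_eq ?_
  linear_combination (cellEq f₁ f₂ t ^ kEq * cellLt f₁ f₂ t ^ kLt * cellGt f₁ f₂ t ^ kGt) * hexp

lemma IsMLE.mleEquation (ht : t ∈ Set.Ioo 0 (min f₁ f₂))
    (h : IsMLE f₁ f₂ kEq kLt kGt t) : MLEEquation f₁ f₂ kEq kLt kGt t := by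
  have hm : 0 < min f₁ f₂ := ht.1.trans ht.2
  have h₁ : 0 < f₁ := hm.trans_le (min_le_left _ _)
  have h₂ : 0 < f₂ := hm.trans_le (min_le_right _ _)
  have t0 := ht.1
  have t1 := ht.2.trans_le (min_le_left _ _)
  have t2 := ht.2.trans_le (min_le_right _ _)
  have hx : f₁ + f₂ - t ≠ 0 := by linarith
  have e1 : f₁ - t ≠ 0 := by linarith
  have e2 : f₂ - t ≠ 0 := by linarith
  have hloc : IsLocalMax (fun u => kEq * Real.log (cellEq f₁ f₂ u) +
      kLt * Real.log (cellLt f₁ f₂ u) + kGt * Real.log (cellGt f₁ f₂ u)) t := by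
    filter_upwards [Ioo_mem_nhds ht.1 ht.2] with u hu
    have hle := h.2 (Set.Ioo_subset_Icc_self hu)
    simp only [Set.mem_ofPred_eq] at hle
    obtain ⟨te, tl, tg⟩ := cell_pos ht
    obtain ⟨ue, ul, ug⟩ := cell_pos hu
    have hle' := Real.log_le_log (by positivity) (le_of_mul_le_mul_left hle multinomial_coeff_pos)
    rwa [Real.log_mul (by positivity) (by positivity), Real.log_mul (by positivity) (by positivity),
      Real.log_mul (by positivity) (by positivity), Real.log_mul (by positivity) (by positivity),
      Real.log_pow, Real.log_pow, Real.log_pow, Real.log_pow, Real.log_pow, Real.log_pow] at hle'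
  obtain ⟨te, tl, tg⟩ := cell_pos ht
  have dden : HasDerivAt (fun u : ℝ => f₁ + f₂ - u) (-1) t := (hasDerivAt_id t).const_sub _
  have dEq := (((hasDerivAt_id t).div dden hx).log te.ne').const_mul (kEq : ℝ)
  have dLt := ((((hasDerivAt_id t).const_sub f₁).div dden hx).log tl.ne').const_mul (kLt : ℝ)
  have dGt := ((((hasDerivAt_id t).const_sub f₂).div dden hx).log tg.ne').const_mul (kGt : ℝ)
  have hd := hloc.hasDerivAt_eq_zero ((dEq.add dLt).add dGt)
  unfold MLEEquation
  simp only [id, Pi.div_apply] at hd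
  -- The derivative of the log-likelihood is the left side of the likelihood equation divided by f₁
  -- + f₂ - t.
  have hd' : (f₁ + f₂ - t)⁻¹ * ((kEq : ℝ) * ((f₁ + f₂) / t) - (kLt : ℝ) * (f₂ / (f₁ - t)) -
      (kGt : ℝ) * (f₁ / (f₂ - t))) = 0 := by
    rw [← hd]
    field_simp
    ring
  exact (mul_eq_zero.1 hd').resolve_left (inv_ne_zero hx)

/-- At t = 0, f₁ or f₂ some cell probability vanishes, and with a positive exponent it makes the
likelihood zero. -/
lemma IsMLE.mem_Ioo (h₁ : 0 < f₁) (h₂ : 0 < f₂) (hEq : 0 < kEq) (hLt : 0 < kLt) (hGt : 0 < kGt)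
    (h : IsMLE f₁ f₂ kEq kLt kGt t) : t ∈ Set.Ioo 0 (min f₁ f₂) := by
  have hpos := (h.likelihood_pos h₁ h₂).ne'
  refine ⟨h.1.1.lt_of_ne ?_, lt_min ((h.1.2.trans (min_le_left _ _)).lt_of_ne ?_)
    ((h.1.2.trans (min_le_right _ _)).lt_of_ne ?_)⟩ <;> rintro rfl <;>
    simp [likelihood, cellEq, cellLt, cellGt, hEq.ne', hLt.ne', hGt.ne'] at hpos

end Likelihood

/-! ### Distribution of the comparison for one random permutation. -/

section Argmin

variable {D : ℕ}

/-- The permutations under which `u` has the smallest image among the elements of `U`. -/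
def permsMinAt (U : Finset (Fin D)) (u : Fin D) : Finset (Equiv.Perm (Fin D)) :=
  Finset.univ.filter fun σ => ∀ v ∈ U, σ u ≤ σ v

lemma mem_permsMinAt {U : Finset (Fin D)} {u : Fin D} {σ : Equiv.Perm (Fin D)} :
    σ ∈ permsMinAt U u ↔ ∀ v ∈ U, σ u ≤ σ v := by
  simp [permsMinAt]

/-- Precomposition with the transposition of u and v preserves U and exchanges the two sets of
permutations. -/
lemma card_permsMinAt_eq {U : Finset (Fin D)} {u v : Fin D} (hu : u ∈ U) (hv : v ∈ U) :
    (permsMinAt U u).card = (permsMinAt U v).card := by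
  have hswap : ∀ w ∈ U, Equiv.swap u v w ∈ U := fun w hw => by
    by_cases h1 : w = u
    · simpa [h1]
    by_cases h2 : w = v
    · simpa [h2]
    rwa [Equiv.swap_apply_of_ne_of_ne h1 h2]
  refine Finset.card_bij (fun σ _ => σ * Equiv.swap u v) (fun σ hσ => ?_)
    (fun σ _ τ _ h => mul_right_cancel h) (fun σ hσ => ⟨σ * Equiv.swap u v, ?_, ?_⟩)
  · rw [mem_permsMinAt] at hσ ⊢
    intro w hw
    simpa using hσ _ (hswap w hw)
  · rw [mem_permsMinAt] at hσ ⊢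
    intro w hw
    simpa using hσ _ (hswap w hw)
  · simp [mul_assoc]

lemma permsMinAt_disjoint {U : Finset (Fin D)} {u v : Fin D} (hu : u ∈ U) (hv : v ∈ U)
    (huv : u ≠ v) : Disjoint (permsMinAt U u) (permsMinAt U v) := by
  rw [Finset.disjoint_left]
  intro σ h1 h2
  rw [mem_permsMinAt] at h1 h2
  exact huv (σ.injective (le_antisymm (h1 v hv) (h2 u hu)))

lemma exists_mem_permsMinAt {U : Finset (Fin D)} (hU : U.Nonempty) (σ : Equiv.Perm (Fin D)) :
    ∃ u ∈ U, σ ∈ permsMinAt U u := by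
  obtain ⟨u, hu, h⟩ := U.exists_min_image σ hU
  exact ⟨u, hu, mem_permsMinAt.2 h⟩

lemma card_biUnion_permsMinAt {U A : Finset (Fin D)} (hA : A ⊆ U) {u : Fin D} (hu : u ∈ U) :
    (A.biUnion (permsMinAt U)).card = A.card * (permsMinAt U u).card := by
  rw [Finset.card_biUnion fun x hx y hy hxy => permsMinAt_disjoint (hA hx) (hA hy) hxy,
    Finset.sum_const_nat fun x hx => card_permsMinAt_eq (hA hx) hu]

/-- The element of `U` with the smallest image under a random permutation is uniform on `U`. -/
lemma card_biUnion_permsMinAt_mul {U A : Finset (Fin D)} (hU : U.Nonempty) (hA : A ⊆ U) :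
    (A.biUnion (permsMinAt U)).card * U.card = A.card * D ! := by
  obtain ⟨u, hu⟩ := hU
  have htop : U.biUnion (permsMinAt U) = Finset.univ := by
    ext σ
    simpa using exists_mem_permsMinAt ⟨u, hu⟩ σ
  have hD := card_biUnion_permsMinAt (subset_refl U) hu
  rw [htop, Finset.card_univ, Fintype.card_perm, Fintype.card_fin] at hD
  rw [card_biUnion_permsMinAt hA hu, hD]
  ring

lemma minHash_eq {σ : Equiv.Perm (Fin D)} {S : Finset (Fin D)} {u : Fin D} (hu : u ∈ S)
    (h : ∀ v ∈ S, σ u ≤ σ v) : minHash σ S = (σ u : WithTop (Fin D)) := by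
  refine le_antisymm (Finset.min_le (Finset.mem_image_of_mem _ hu)) (Finset.le_min ?_)
  intro x hx
  obtain ⟨v, hv, rfl⟩ := Finset.mem_image.1 hx
  exact WithTop.coe_le_coe.2 (h v hv)

lemma lt_minHash {σ : Equiv.Perm (Fin D)} {S : Finset (Fin D)} {u : Fin D}
    (hu : u ∉ S) (h : ∀ v ∈ S, σ u ≤ σ v) : (σ u : WithTop (Fin D)) < minHash σ S := by
  rcases S.eq_empty_or_nonempty with rfl | hS
  · simp [minHash]
  obtain ⟨v, hv, hmin⟩ := S.exists_min_image σ hS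
  rw [minHash_eq hv hmin, WithTop.coe_lt_coe]
  refine (h v hv).lt_of_ne fun he => hu ?_
  rwa [σ.injective he]

variable {S₁ S₂ : Finset (Fin D)} {σ : Equiv.Perm (Fin D)} {u : Fin D}

lemma minHash_eq_of_mem_inter (hu : u ∈ S₁ ∩ S₂) (h : σ ∈ permsMinAt (S₁ ∪ S₂) u) :
    minHash σ S₁ = minHash σ S₂ := by
  rw [mem_permsMinAt] at h
  rw [Finset.mem_inter] at hu
  rw [minHash_eq hu.1 fun v hv => h v (Finset.mem_union_left _ hv),
    minHash_eq hu.2 fun v hv => h v (Finset.mem_union_right _ hv)]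

lemma minHash_lt_of_mem_left (hu : u ∈ S₁ \ S₂) (h : σ ∈ permsMinAt (S₁ ∪ S₂) u) :
    minHash σ S₁ < minHash σ S₂ := by
  rw [mem_permsMinAt] at h
  rw [Finset.mem_sdiff] at hu
  rw [minHash_eq hu.1 fun v hv => h v (Finset.mem_union_left _ hv)]
  exact lt_minHash hu.2 fun v hv => h v (Finset.mem_union_right _ hv)

lemma minHash_lt_of_mem_right (hu : u ∈ S₂ \ S₁) (h : σ ∈ permsMinAt (S₁ ∪ S₂) u) :
    minHash σ S₂ < minHash σ S₁ :=
  minHash_lt_of_mem_left hu (by rwa [Finset.union_comm])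

/-- The contribution of a permutation to the three counts. -/
def hashStep (S₁ S₂ : Finset (Fin D)) (σ : Equiv.Perm (Fin D)) : ℕ × ℕ × ℕ :=
  (if minHash σ S₁ = minHash σ S₂ then 1 else 0, if minHash σ S₁ < minHash σ S₂ then 1 else 0,
    if minHash σ S₂ < minHash σ S₁ then 1 else 0)

lemma hashStep_cases (S₁ S₂ : Finset (Fin D)) (hne : (S₁ ∪ S₂).Nonempty) (σ : Equiv.Perm (Fin D)) :
    (σ ∈ (S₁ ∩ S₂).biUnion (permsMinAt (S₁ ∪ S₂)) ∧ hashStep S₁ S₂ σ = (1, 0, 0)) ∨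
    (σ ∈ (S₁ \ S₂).biUnion (permsMinAt (S₁ ∪ S₂)) ∧ hashStep S₁ S₂ σ = (0, 1, 0)) ∨
    (σ ∈ (S₂ \ S₁).biUnion (permsMinAt (S₁ ∪ S₂)) ∧ hashStep S₁ S₂ σ = (0, 0, 1)) := by
  obtain ⟨u, hu, hσ⟩ := exists_mem_permsMinAt hne σ
  by_cases h1 : u ∈ S₁ <;> by_cases h2 : u ∈ S₂
  · have hu' : u ∈ S₁ ∩ S₂ := Finset.mem_inter.2 ⟨h1, h2⟩
    have := minHash_eq_of_mem_inter hu' hσ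
    exact Or.inl ⟨Finset.mem_biUnion.2 ⟨u, hu', hσ⟩, by simp [hashStep, this]⟩
  · have hu' : u ∈ S₁ \ S₂ := Finset.mem_sdiff.2 ⟨h1, h2⟩
    have := minHash_lt_of_mem_left hu' hσ
    exact Or.inr (Or.inl ⟨Finset.mem_biUnion.2 ⟨u, hu', hσ⟩,
      by simp [hashStep, this, this.ne, this.le]⟩)
  · have hu' : u ∈ S₂ \ S₁ := Finset.mem_sdiff.2 ⟨h2, h1⟩
    have := minHash_lt_of_mem_right hu' hσ
    exact Or.inr (Or.inr ⟨Finset.mem_biUnion.2 ⟨u, hu', hσ⟩,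
      by simp [hashStep, this, this.ne', this.le]⟩)
  · simp [h1, h2] at hu

lemma sum_hashStep (S₁ S₂ : Finset (Fin D)) (hne : (S₁ ∪ S₂).Nonempty) (F : ℕ × ℕ × ℕ → ℝ) :
    ∑ σ, F (hashStep S₁ S₂ σ) =
      ((S₁ ∩ S₂).biUnion (permsMinAt (S₁ ∪ S₂))).card * F (1, 0, 0) +
      ((S₁ \ S₂).biUnion (permsMinAt (S₁ ∪ S₂))).card * F (0, 1, 0) +
      ((S₂ \ S₁).biUnion (permsMinAt (S₁ ∪ S₂))).card * F (0, 0, 1) := by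
  have hval : ∀ {A : Finset (Fin D)} {c : ℕ × ℕ × ℕ},
      (∀ u ∈ A, ∀ σ ∈ permsMinAt (S₁ ∪ S₂) u, hashStep S₁ S₂ σ = c) →
      ∀ σ ∈ A.biUnion (permsMinAt (S₁ ∪ S₂)), F (hashStep S₁ S₂ σ) = F c := by
    intro A c h σ hσ
    obtain ⟨u, hu, hσ⟩ := Finset.mem_biUnion.1 hσ
    rw [h u hu σ hσ]
  have v1 := hval (A := S₁ ∩ S₂) (c := (1, 0, 0)) fun u hu σ hσ => by
    simp [hashStep, minHash_eq_of_mem_inter hu hσ]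
  have v2 := hval (A := S₁ \ S₂) (c := (0, 1, 0)) fun u hu σ hσ => by
    have := minHash_lt_of_mem_left hu hσ
    simp [hashStep, this, this.ne, this.le]
  have v3 := hval (A := S₂ \ S₁) (c := (0, 0, 1)) fun u hu σ hσ => by
    have := minHash_lt_of_mem_right hu hσ
    simp [hashStep, this, this.ne', this.le]
  have disj : ∀ {A B : Finset (Fin D)}, A ⊆ S₁ ∪ S₂ → B ⊆ S₁ ∪ S₂ → Disjoint A B →
      Disjoint (A.biUnion (permsMinAt (S₁ ∪ S₂))) (B.biUnion (permsMinAt (S₁ ∪ S₂))) := by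
    intro A B hA hB hAB
    rw [Finset.disjoint_biUnion_left]
    intro x hx
    rw [Finset.disjoint_biUnion_right]
    intro y hy
    exact permsMinAt_disjoint (hA hx) (hB hy) fun h => Finset.disjoint_left.1 hAB hx (h ▸ hy)
  have s1 : S₁ ∩ S₂ ⊆ S₁ ∪ S₂ := Finset.inter_subset_left.trans Finset.subset_union_left
  have s2 : S₁ \ S₂ ⊆ S₁ ∪ S₂ := Finset.sdiff_subset.trans Finset.subset_union_left
  have s3 : S₂ \ S₁ ⊆ S₁ ∪ S₂ := Finset.sdiff_subset.trans Finset.subset_union_right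
  have d12 := disj s1 s2 (Finset.disjoint_left.2 fun x => by simp; tauto)
  have d13 := disj s1 s3 (Finset.disjoint_left.2 fun x => by simp; tauto)
  have d23 := disj s2 s3 (Finset.disjoint_left.2 fun x => by simp; tauto)
  have huniv : (Finset.univ : Finset (Equiv.Perm (Fin D))) =
      ((S₁ ∩ S₂).biUnion (permsMinAt (S₁ ∪ S₂)) ∪ (S₁ \ S₂).biUnion (permsMinAt (S₁ ∪ S₂))) ∪
        (S₂ \ S₁).biUnion (permsMinAt (S₁ ∪ S₂)) := by
    refine (Finset.eq_univ_of_forall fun σ => ?_).symm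
    rw [Finset.mem_union, Finset.mem_union, or_assoc]
    exact (hashStep_cases S₁ S₂ hne σ).imp And.left (Or.imp And.left And.left)
  rw [huniv, Finset.sum_union (Finset.disjoint_union_left.2 ⟨d13, d23⟩), Finset.sum_union d12,
    Finset.sum_congr rfl v1, Finset.sum_congr rfl v2, Finset.sum_congr rfl v3]
  simp

/-- The three pieces of the union have a, f₁ - a and f₂ - a elements out of f₁ + f₂ - a, so
uniformity of the minimizing element gives the cell probabilities. -/
lemma average_hashStep (S₁ S₂ : Finset (Fin D)) (hne : (S₁ ∪ S₂).Nonempty) {f₁ f₂ a : ℝ}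
    (hf₁ : f₁ = S₁.card) (hf₂ : f₂ = S₂.card) (ha : a = (S₁ ∩ S₂).card)
    (F : ℕ × ℕ × ℕ → ℝ) :
    1 / (D ! : ℝ) * ∑ σ, F (hashStep S₁ S₂ σ) =
      cellEq f₁ f₂ a * F (1, 0, 0) + cellLt f₁ f₂ a * F (0, 1, 0) +
        cellGt f₁ f₂ a * F (0, 0, 1) := by
  have hD : (D ! : ℝ) ≠ 0 := by positivity
  have hU : (((S₁ ∪ S₂).card : ℕ) : ℝ) = f₁ + f₂ - a := by
    have := Finset.card_union_add_card_inter S₁ S₂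
    rw [hf₁, hf₂, ha, eq_sub_iff_add_eq]
    exact_mod_cast this
  have hU0 : f₁ + f₂ - a ≠ 0 := by
    rw [← hU]
    exact_mod_cast (Finset.card_pos.2 hne).ne'
  have hL : (((S₁ \ S₂).card : ℕ) : ℝ) = f₁ - a := by
    have := Finset.card_sdiff_add_card_inter S₁ S₂
    rw [hf₁, ha, eq_sub_iff_add_eq]
    exact_mod_cast this
  have hG : (((S₂ \ S₁).card : ℕ) : ℝ) = f₂ - a := by
    have := Finset.card_sdiff_add_card_inter S₂ S₁
    rw [hf₂, ha, eq_sub_iff_add_eq, Finset.inter_comm]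
    exact_mod_cast this
  have frac : ∀ {A : Finset (Fin D)} {x : ℝ}, A ⊆ S₁ ∪ S₂ → (A.card : ℝ) = x →
      ((A.biUnion (permsMinAt (S₁ ∪ S₂))).card : ℝ) = x / (f₁ + f₂ - a) * D ! := by
    intro A x hA hx
    have := card_biUnion_permsMinAt_mul hne hA
    rw [div_mul_eq_mul_div, eq_div_iff hU0, ← hU, ← hx]
    exact_mod_cast this
  rw [sum_hashStep S₁ S₂ hne, frac (Finset.inter_subset_left.trans Finset.subset_union_left) ha.symm,
    frac (Finset.sdiff_subset.trans Finset.subset_union_left) hL,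
    frac (Finset.sdiff_subset.trans Finset.subset_union_right) hG]
  unfold cellEq cellLt cellGt
  field_simp

end Argmin

/-! ### Trinomial expectations and their moments up to order four. -/

section Trinomial

/-- The expectation of `F` under the trinomial distribution with `k` trials and cell weights
`p`, `q`, `r`, computed trial by trial. -/
def trinomialExp (p q r : ℝ) : ℕ → (ℕ × ℕ × ℕ → ℝ) → ℝ
  | 0, F => F 0
  | k + 1, F => p * trinomialExp p q r k (fun n => F (n + (1, 0, 0))) +
      q * trinomialExp p q r k (fun n => F (n + (0, 1, 0))) +
      r * trinomialExp p q r k (fun n => F (n + (0, 0, 1)))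

/-- The total number of trials recorded by a triple of counts. -/
def trials (n : ℕ × ℕ × ℕ) : ℕ := n.1 + n.2.1 + n.2.2

variable {p q r : ℝ}

lemma trinomialExp_add (k : ℕ) (F G : ℕ × ℕ × ℕ → ℝ) :
    trinomialExp p q r k (fun n => F n + G n) =
      trinomialExp p q r k F + trinomialExp p q r k G := by
  induction k generalizing F G with
  | zero => rfl
  | succ k ih => simp only [trinomialExp, ih]; ring

lemma trinomialExp_mul_left (k : ℕ) (c : ℝ) (F : ℕ × ℕ × ℕ → ℝ) :
    trinomialExp p q r k (fun n => c * F n) = c * trinomialExp p q r k F := by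
  induction k generalizing F with
  | zero => rfl
  | succ k ih => simp only [trinomialExp, ih]; ring

lemma trinomialExp_const (hs : p + q + r = 1) (k : ℕ) (c : ℝ) :
    trinomialExp p q r k (fun _ => c) = c := by
  induction k with
  | zero => rfl
  | succ k ih => simp only [trinomialExp, ih]; linear_combination c * hs

lemma trinomialExp_mono (hp : 0 ≤ p) (hq : 0 ≤ q) (hr : 0 ≤ r) {k : ℕ} {F G : ℕ × ℕ × ℕ → ℝ}
    (h : ∀ n, trials n = k → F n ≤ G n) : trinomialExp p q r k F ≤ trinomialExp p q r k G := by
  induction k generalizing F G with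
  | zero => exact h 0 rfl
  | succ k ih =>
    have step : ∀ c : ℕ × ℕ × ℕ, trials c = 1 →
        trinomialExp p q r k (fun n => F (n + c)) ≤ trinomialExp p q r k (fun n => G (n + c)) :=
      fun c hc => ih fun n hn => h _ (by simp only [trials, Prod.fst_add, Prod.snd_add] at *; omega)
    simp only [trinomialExp]
    have h1 := mul_le_mul_of_nonneg_left (step (1, 0, 0) rfl) hp
    have h2 := mul_le_mul_of_nonneg_left (step (0, 1, 0) rfl) hq
    have h3 := mul_le_mul_of_nonneg_left (step (0, 0, 1) rfl) hr
    linarith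

lemma trinomialExp_congr (hp : 0 ≤ p) (hq : 0 ≤ q) (hr : 0 ≤ r) {k : ℕ} {F G : ℕ × ℕ × ℕ → ℝ}
    (h : ∀ n, trials n = k → F n = G n) : trinomialExp p q r k F = trinomialExp p q r k G :=
  le_antisymm (trinomialExp_mono hp hq hr fun n hn => (h n hn).le)
    (trinomialExp_mono hp hq hr fun n hn => (h n hn).ge)

lemma abs_trinomialExp_le (hp : 0 ≤ p) (hq : 0 ≤ q) (hr : 0 ≤ r) {k : ℕ} {F G : ℕ × ℕ × ℕ → ℝ}
    (h : ∀ n, trials n = k → |F n| ≤ G n) : |trinomialExp p q r k F| ≤ trinomialExp p q r k G := by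
  refine abs_le.2 ⟨?_, trinomialExp_mono hp hq hr fun n hn => (le_abs_self _).trans (h n hn)⟩
  have := trinomialExp_mono (F := fun n => -1 * G n) (G := F) hp hq hr fun n hn => by
    linarith [neg_abs_le (F n), h n hn]
  rw [trinomialExp_mul_left] at this
  linarith

lemma trinomialExp_indicator (x y z : ℕ) :
    trinomialExp p q r (x + y + z) (fun n => if n = (x, y, z) then 1 else 0) =
      (((x + y + z)! : ℝ) / ((x ! : ℝ) * (y ! : ℝ) * (z ! : ℝ))) * (p ^ x * q ^ y * r ^ z) := by
  obtain ⟨k, hk⟩ : ∃ k, x + y + z = k := ⟨_, rfl⟩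
  rw [hk]
  induction k generalizing x y z with
  | zero =>
    obtain ⟨rfl, rfl, rfl⟩ : x = 0 ∧ y = 0 ∧ z = 0 := by omega
    simp [trinomialExp, Prod.ext_iff]
  | succ k ih =>
    -- Each of the three branches contributes x, y or z times a common factor, also when that count
    -- is zero. The factors add up to k + 1, which completes the factorial.
    have ex : p * trinomialExp p q r k (fun n => if n + (1, 0, 0) = (x, y, z) then 1 else 0) =
        x * (((k ! : ℝ) / ((x ! : ℝ) * (y ! : ℝ) * (z ! : ℝ))) * (p ^ x * q ^ y * r ^ z)) := by
      cases x with
      | zero =>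
        have : ∀ n : ℕ × ℕ × ℕ, n + (1, 0, 0) ≠ (0, y, z) := fun n h => by
          simpa using congrArg Prod.fst h
        simp only [this, if_false]
        have := trinomialExp_mul_left (p := p) (q := q) (r := r) k 0 (fun _ => 0)
        simp only [mul_zero, zero_mul] at this
        simp [this]
      | succ x =>
        have : ∀ n : ℕ × ℕ × ℕ, n + (1, 0, 0) = (x + 1, y, z) ↔ n = (x, y, z) := fun n => by
          simp [Prod.ext_iff]
        simp only [this]
        rw [ih x y z (by omega), Nat.factorial_succ]
        push_cast
        field_simp
        ring
    have ey : q * trinomialExp p q r k (fun n => if n + (0, 1, 0) = (x, y, z) then 1 else 0) =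
        y * (((k ! : ℝ) / ((x ! : ℝ) * (y ! : ℝ) * (z ! : ℝ))) * (p ^ x * q ^ y * r ^ z)) := by
      cases y with
      | zero =>
        have : ∀ n : ℕ × ℕ × ℕ, n + (0, 1, 0) ≠ (x, 0, z) := fun n h => by
          simpa using congrArg (fun m => m.2.1) h
        simp only [this, if_false]
        have := trinomialExp_mul_left (p := p) (q := q) (r := r) k 0 (fun _ => 0)
        simp only [mul_zero, zero_mul] at this
        simp [this]
      | succ y =>
        have : ∀ n : ℕ × ℕ × ℕ, n + (0, 1, 0) = (x, y + 1, z) ↔ n = (x, y, z) := fun n => by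
          simp [Prod.ext_iff]
        simp only [this]
        rw [ih x y z (by omega), Nat.factorial_succ]
        push_cast
        field_simp
        ring
    have ez : r * trinomialExp p q r k (fun n => if n + (0, 0, 1) = (x, y, z) then 1 else 0) =
        z * (((k ! : ℝ) / ((x ! : ℝ) * (y ! : ℝ) * (z ! : ℝ))) * (p ^ x * q ^ y * r ^ z)) := by
      cases z with
      | zero =>
        have : ∀ n : ℕ × ℕ × ℕ, n + (0, 0, 1) ≠ (x, y, 0) := fun n h => by
          simpa using congrArg (fun m => m.2.2) h
        simp only [this, if_false]
        have := trinomialExp_mul_left (p := p) (q := q) (r := r) k 0 (fun _ => 0)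
        simp only [mul_zero, zero_mul] at this
        simp [this]
      | succ z =>
        have : ∀ n : ℕ × ℕ × ℕ, n + (0, 0, 1) = (x, y, z + 1) ↔ n = (x, y, z) := fun n => by
          simp [Prod.ext_iff]
        simp only [this]
        rw [ih x y z (by omega), Nat.factorial_succ]
        push_cast
        field_simp
        ring
    have hk' : ((k : ℝ) + 1) = x + y + z := by exact_mod_cast hk.symm
    simp only [trinomialExp]
    rw [ex, ey, ez, Nat.factorial_succ]
    push_cast
    rw [hk']
    ring

/-- A linear form in the counts. -/
def countForm (α β γ : ℝ) (n : ℕ × ℕ × ℕ) : ℝ := α * n.1 + β * n.2.1 + γ * n.2.2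

variable {α β γ : ℝ}

lemma trinomialExp_succ_countForm (k : ℕ) (g : ℝ → ℝ) :
    trinomialExp p q r (k + 1) (fun n => g (countForm α β γ n)) =
      p * trinomialExp p q r k (fun n => g (countForm α β γ n + α)) +
      q * trinomialExp p q r k (fun n => g (countForm α β γ n + β)) +
      r * trinomialExp p q r k (fun n => g (countForm α β γ n + γ)) := by
  have h1 : ∀ n, countForm α β γ (n + (1, 0, 0)) = countForm α β γ n + α := fun n => by
    simp [countForm]; ring
  have h2 : ∀ n, countForm α β γ (n + (0, 1, 0)) = countForm α β γ n + β := fun n => by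
    simp [countForm]; ring
  have h3 : ∀ n, countForm α β γ (n + (0, 0, 1)) = countForm α β γ n + γ := fun n => by
    simp [countForm]; ring
  simp only [trinomialExp, h1, h2, h3]

lemma trinomialExp_countForm (hs : p + q + r = 1) (hm : p * α + q * β + r * γ = 0) (k : ℕ) :
    trinomialExp p q r k (countForm α β γ) = 0 := by
  induction k with
  | zero => simp [trinomialExp, countForm]
  | succ k ih =>
    rw [trinomialExp_succ_countForm k fun x => x]
    simp only [trinomialExp_add, trinomialExp_const hs, ih]
    linear_combination hm

lemma trinomialExp_countForm_sq (hs : p + q + r = 1) (hm : p * α + q * β + r * γ = 0) (k : ℕ) :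
    trinomialExp p q r k (fun n => countForm α β γ n ^ 2) =
      k * (p * α ^ 2 + q * β ^ 2 + r * γ ^ 2) := by
  induction k with
  | zero => simp [trinomialExp, countForm]
  | succ k ih =>
    have hexp : ∀ c : ℝ, trinomialExp p q r k (fun n => (countForm α β γ n + c) ^ 2) =
        k * (p * α ^ 2 + q * β ^ 2 + r * γ ^ 2) + c ^ 2 := fun c => by
      have : (fun n => (countForm α β γ n + c) ^ 2) = fun n =>
          countForm α β γ n ^ 2 + (2 * c * countForm α β γ n + c ^ 2) := by funext n; ring
      rw [this, trinomialExp_add, trinomialExp_add, trinomialExp_mul_left, trinomialExp_const hs,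
        trinomialExp_countForm hs hm, ih]
      ring
    rw [trinomialExp_succ_countForm k fun x => x ^ 2, hexp, hexp, hexp]
    push_cast
    linear_combination (k * (p * α ^ 2 + q * β ^ 2 + r * γ ^ 2)) * hs

/-- In the cube of a sum of k independent centred terms all mixed products have mean zero. The
resulting linear growth in k is what keeps the cubic terms at order 1/k². -/
lemma trinomialExp_countForm_cube (hs : p + q + r = 1) (hm : p * α + q * β + r * γ = 0) (k : ℕ) :
    trinomialExp p q r k (fun n => countForm α β γ n ^ 3) =
      k * (p * α ^ 3 + q * β ^ 3 + r * γ ^ 3) := by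
  induction k with
  | zero => simp [trinomialExp, countForm]
  | succ k ih =>
    have hexp : ∀ c : ℝ, trinomialExp p q r k (fun n => (countForm α β γ n + c) ^ 3) =
        k * (p * α ^ 3 + q * β ^ 3 + r * γ ^ 3) +
          3 * c * (k * (p * α ^ 2 + q * β ^ 2 + r * γ ^ 2)) + c ^ 3 := fun c => by
      have : (fun n => (countForm α β γ n + c) ^ 3) = fun n =>
          countForm α β γ n ^ 3 + (3 * c * countForm α β γ n ^ 2 +
            (3 * c ^ 2 * countForm α β γ n + c ^ 3)) := by funext n; ring
      rw [this, trinomialExp_add, trinomialExp_add, trinomialExp_add, trinomialExp_mul_left,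
        trinomialExp_mul_left, trinomialExp_const hs,
        trinomialExp_countForm hs hm, trinomialExp_countForm_sq hs hm, ih]
      ring
    rw [trinomialExp_succ_countForm k fun x => x ^ 3, hexp, hexp, hexp]
    push_cast
    linear_combination (k * (p * α ^ 3 + q * β ^ 3 + r * γ ^ 3)) * hs +
      3 * (k * (p * α ^ 2 + q * β ^ 2 + r * γ ^ 2)) * hm

/-- Besides the k pure fourth powers, only products of two squares from distinct trials survive
centring; there are 3k(k - 1) of them. -/
lemma trinomialExp_countForm_fourth (hs : p + q + r = 1) (hm : p * α + q * β + r * γ = 0) (k : ℕ) :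
    trinomialExp p q r k (fun n => countForm α β γ n ^ 4) =
      k * (p * α ^ 4 + q * β ^ 4 + r * γ ^ 4) +
        3 * k * (k - 1) * (p * α ^ 2 + q * β ^ 2 + r * γ ^ 2) ^ 2 := by
  induction k with
  | zero => simp [trinomialExp, countForm]
  | succ k ih =>
    have hexp : ∀ c : ℝ, trinomialExp p q r k (fun n => (countForm α β γ n + c) ^ 4) =
        k * (p * α ^ 4 + q * β ^ 4 + r * γ ^ 4) +
          3 * k * (k - 1) * (p * α ^ 2 + q * β ^ 2 + r * γ ^ 2) ^ 2 +
          4 * c * (k * (p * α ^ 3 + q * β ^ 3 + r * γ ^ 3)) +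
          6 * c ^ 2 * (k * (p * α ^ 2 + q * β ^ 2 + r * γ ^ 2)) + c ^ 4 := fun c => by
      have : (fun n => (countForm α β γ n + c) ^ 4) = fun n =>
          countForm α β γ n ^ 4 + (4 * c * countForm α β γ n ^ 3 +
            (6 * c ^ 2 * countForm α β γ n ^ 2 +
              (4 * c ^ 3 * countForm α β γ n + c ^ 4))) := by funext n; ring
      rw [this, trinomialExp_add, trinomialExp_add, trinomialExp_add, trinomialExp_add,
        trinomialExp_mul_left, trinomialExp_mul_left, trinomialExp_mul_left, trinomialExp_const hs,
        trinomialExp_countForm hs hm, trinomialExp_countForm_sq hs hm,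
        trinomialExp_countForm_cube hs hm, ih]
      ring
    rw [trinomialExp_succ_countForm k fun x => x ^ 4, hexp, hexp, hexp]
    push_cast
    linear_combination (k * (p * α ^ 4 + q * β ^ 4 + r * γ ^ 4) +
      3 * k * (k - 1) * (p * α ^ 2 + q * β ^ 2 + r * γ ^ 2) ^ 2) * hs +
      4 * (k * (p * α ^ 3 + q * β ^ 3 + r * γ ^ 3)) * hm

/-- A linear form in the deviations of the observed cell frequencies from `p`, `q`, `r`. -/
noncomputable def devForm (p q r α β γ : ℝ) (n : ℕ × ℕ × ℕ) : ℝ :=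
  α * (n.1 / trials n - p) + β * (n.2.1 / trials n - q) + γ * (n.2.2 / trials n - r)

/-- The counts sum to k, so subtracting the mean from every coefficient accounts for the constants
p, q, r. The new coefficients are centred, as the moment formulas require. -/
lemma devForm_eq {k : ℕ} (hk : 0 < k) {n : ℕ × ℕ × ℕ} (hn : trials n = k) :
    devForm p q r α β γ n = (k : ℝ)⁻¹ * countForm (α - (p * α + q * β + r * γ))
      (β - (p * α + q * β + r * γ)) (γ - (p * α + q * β + r * γ)) n := by
  have hk' : (k : ℝ) ≠ 0 := by exact_mod_cast hk.ne'
  have hsum : (n.1 : ℝ) + n.2.1 + n.2.2 = k := by exact_mod_cast hn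
  unfold devForm countForm
  rw [hn]
  field_simp
  linear_combination (p * α + q * β + r * γ) * hsum


lemma trinomialExp_devForm_pow (hp : 0 ≤ p) (hq : 0 ≤ q) (hr : 0 ≤ r) {k : ℕ} (hk : 0 < k)
    (i : ℕ) : trinomialExp p q r k (fun n => devForm p q r α β γ n ^ i) =
      ((k : ℝ)⁻¹) ^ i * trinomialExp p q r k (fun n => countForm (α - (p * α + q * β + r * γ))
        (β - (p * α + q * β + r * γ)) (γ - (p * α + q * β + r * γ)) n ^ i) := by
  rw [← trinomialExp_mul_left]
  exact trinomialExp_congr hp hq hr fun n hn => by rw [devForm_eq hk hn, mul_pow]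

lemma centered_mean (hs : p + q + r = 1) (α β γ : ℝ) :
    p * (α - (p * α + q * β + r * γ)) + q * (β - (p * α + q * β + r * γ)) +
      r * (γ - (p * α + q * β + r * γ)) = 0 := by
  linear_combination -(p * α + q * β + r * γ) * hs

lemma trinomialExp_devForm (hp : 0 ≤ p) (hq : 0 ≤ q) (hr : 0 ≤ r) (hs : p + q + r = 1) {k : ℕ}
    (hk : 0 < k) : trinomialExp p q r k (devForm p q r α β γ) = 0 := by
  have := trinomialExp_devForm_pow (α := α) (β := β) (γ := γ) hp hq hr hk 1
  simp only [pow_one] at this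
  rw [this, trinomialExp_countForm hs (centered_mean hs α β γ), mul_zero]

lemma trinomialExp_devForm_sq (hp : 0 ≤ p) (hq : 0 ≤ q) (hr : 0 ≤ r) (hs : p + q + r = 1) {k : ℕ}
    (hk : 0 < k) : trinomialExp p q r k (fun n => devForm p q r α β γ n ^ 2) =
      (k : ℝ)⁻¹ * (p * α ^ 2 + q * β ^ 2 + r * γ ^ 2 - (p * α + q * β + r * γ) ^ 2) := by
  have hk' : (k : ℝ) ≠ 0 := by exact_mod_cast hk.ne'
  rw [trinomialExp_devForm_pow hp hq hr hk,
    trinomialExp_countForm_sq hs (centered_mean hs α β γ)]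
  field_simp
  linear_combination (p * α + q * β + r * γ) ^ 2 * hs

lemma exists_abs_trinomialExp_devForm_cube_le (hp : 0 ≤ p) (hq : 0 ≤ q) (hr : 0 ≤ r)
    (hs : p + q + r = 1) (α β γ : ℝ) : ∃ C, ∀ k : ℕ, 0 < k →
      |trinomialExp p q r k (fun n => devForm p q r α β γ n ^ 3)| ≤ C * (1 / (k : ℝ) ^ 2) := by
  set m := p * α + q * β + r * γ with hm
  refine ⟨|p * (α - m) ^ 3 + q * (β - m) ^ 3 + r * (γ - m) ^ 3|, fun k hk => le_of_eq ?_⟩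
  have hk' : (0 : ℝ) < k := by exact_mod_cast hk
  rw [trinomialExp_devForm_pow hp hq hr hk,
    trinomialExp_countForm_cube hs (centered_mean hs α β γ), ← hm, abs_mul, abs_mul,
    abs_of_pos hk', abs_of_pos (by positivity)]
  field_simp

lemma exists_trinomialExp_devForm_fourth_le (hp : 0 ≤ p) (hq : 0 ≤ q) (hr : 0 ≤ r)
    (hs : p + q + r = 1) (α β γ : ℝ) : ∃ C, ∀ k : ℕ, 0 < k →
      trinomialExp p q r k (fun n => devForm p q r α β γ n ^ 4) ≤ C * (1 / (k : ℝ) ^ 2) := by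
  set m := p * α + q * β + r * γ with hm
  refine ⟨(p * (α - m) ^ 4 + q * (β - m) ^ 4 + r * (γ - m) ^ 4) +
    3 * (p * (α - m) ^ 2 + q * (β - m) ^ 2 + r * (γ - m) ^ 2) ^ 2, fun k hk => ?_⟩
  have hk' : (1 : ℝ) ≤ k := by exact_mod_cast hk
  rw [trinomialExp_devForm_pow hp hq hr hk,
    trinomialExp_countForm_fourth hs (centered_mean hs α β γ), ← hm]
  have hA : 0 ≤ p * (α - m) ^ 4 + q * (β - m) ^ 4 + r * (γ - m) ^ 4 := by positivity
  generalize p * (α - m) ^ 4 + q * (β - m) ^ 4 + r * (γ - m) ^ 4 = A at *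
  generalize p * (α - m) ^ 2 + q * (β - m) ^ 2 + r * (γ - m) ^ 2 = V
  have key : k * A + 3 * k * (k - 1) * V ^ 2 ≤ (A + 3 * V ^ 2) * (k : ℝ) ^ 2 := by
    nlinarith [mul_nonneg hA (by nlinarith : (0 : ℝ) ≤ k ^ 2 - k), mul_nonneg (sq_nonneg V)
      (by linarith : (0 : ℝ) ≤ k)]
  calc _ ≤ ((k : ℝ)⁻¹) ^ 4 * ((A + 3 * V ^ 2) * (k : ℝ) ^ 2) :=
        mul_le_mul_of_nonneg_left key (by positivity)
    _ = _ := by field_simp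

end Trinomial

/-! ### From the random permutations to trinomial expectations. -/

section Counts

variable {D : ℕ}

/-- The triple of counts `(k_=, k_<, k_>)`. -/
def hashCounts (S₁ S₂ : Finset (Fin D)) (k : ℕ) (p : ℕ → Equiv.Perm (Fin D)) : ℕ × ℕ × ℕ :=
  (countEq S₁ S₂ k p, countLt S₁ S₂ k p, countGt S₁ S₂ k p)

lemma hashCounts_eq_sum (S₁ S₂ : Finset (Fin D)) (k : ℕ) (p : ℕ → Equiv.Perm (Fin D)) :
    hashCounts S₁ S₂ k p = ∑ j ∈ Finset.range k, hashStep S₁ S₂ (p j) := by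
  simp [hashCounts, hashStep, countEq, countLt, countGt, Prod.ext_iff, Prod.fst_sum, Prod.snd_sum]

lemma trials_hashCounts {S₁ S₂ : Finset (Fin D)} (hne : (S₁ ∪ S₂).Nonempty) (k : ℕ)
    (p : ℕ → Equiv.Perm (Fin D)) : trials (hashCounts S₁ S₂ k p) = k := by
  have hstep : ∀ σ, trials (hashStep S₁ S₂ σ) = 1 := fun σ => by
    rcases hashStep_cases S₁ S₂ hne σ with ⟨-, h⟩ | ⟨-, h⟩ | ⟨-, h⟩ <;> rw [h] <;> rfl
  have hadd : ∀ m n, trials (m + n) = trials m + trials n := fun m n => by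
    simp only [trials, Prod.fst_add, Prod.snd_add]
    ring
  induction k with
  | zero => simp [hashCounts_eq_sum, trials]
  | succ k ih =>
    rw [hashCounts_eq_sum, Finset.sum_range_succ, ← hashCounts_eq_sum, hadd, ih, hstep]

lemma finite_trials_eq (k : ℕ) : {n : ℕ × ℕ × ℕ | trials n = k}.Finite := by
  refine Set.Finite.subset (Finset.finite_toSet
    (Finset.range (k + 1) ×ˢ (Finset.range (k + 1) ×ˢ Finset.range (k + 1)))) fun n hn => ?_
  simp only [Set.mem_ofPred_eq, trials] at hn
  simp only [Finset.mem_coe, Finset.mem_product, Finset.mem_range]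
  omega

variable {Ω : Type*} [MeasurableSpace Ω] {μ : Measure Ω} {π : ℕ → Ω → Equiv.Perm (Fin D)}

lemma measurable_hashStep_comp (S₁ S₂ : Finset (Fin D))
    (hπ : ∀ j σ, MeasurableSet {ω | π j ω = σ}) (j : ℕ) :
    Measurable fun ω => hashStep S₁ S₂ (π j ω) := by
  let _ : MeasurableSpace (Equiv.Perm (Fin D)) := ⊤
  have : Measurable (π j) := measurable_to_countable' fun σ => hπ j σ
  exact (measurable_from_top (f := hashStep S₁ S₂)).comp this

lemma measurable_hashCounts (S₁ S₂ : Finset (Fin D))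
    (hπ : ∀ j σ, MeasurableSet {ω | π j ω = σ}) (k : ℕ) :
    Measurable fun ω => hashCounts S₁ S₂ k (fun j => π j ω) := by
  simp only [hashCounts_eq_sum]
  exact Finset.measurable_fun_sum _ fun j _ => measurable_hashStep_comp S₁ S₂ hπ j

/-- The counts sum to k, so they take finitely many values and any function of them is bounded. -/
lemma memLp_comp_hashCounts [IsProbabilityMeasure μ] {S₁ S₂ : Finset (Fin D)}
    (hne : (S₁ ∪ S₂).Nonempty) (hπ : ∀ j σ, MeasurableSet {ω | π j ω = σ}) (k : ℕ)
    (F : ℕ × ℕ × ℕ → ℝ) (s : ENNReal) :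
    MemLp (fun ω => F (hashCounts S₁ S₂ k (fun j => π j ω))) s μ := by
  obtain ⟨C, hC⟩ := ((finite_trials_eq k).image fun n => ‖F n‖).bddAbove
  refine MemLp.of_bound ((measurable_of_countable F).comp
    (measurable_hashCounts S₁ S₂ hπ k)).aestronglyMeasurable C (ae_of_all _ fun ω => ?_)
  exact hC ⟨_, trials_hashCounts hne k _, rfl⟩

lemma integrable_comp_hashCounts [IsProbabilityMeasure μ] {S₁ S₂ : Finset (Fin D)}
    (hne : (S₁ ∪ S₂).Nonempty) (hπ : ∀ j σ, MeasurableSet {ω | π j ω = σ}) (k : ℕ)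
    (F : ℕ × ℕ × ℕ → ℝ) :
    Integrable (fun ω => F (hashCounts S₁ S₂ k (fun j => π j ω))) μ :=
  memLp_one_iff_integrable.1 (memLp_comp_hashCounts hne hπ k F 1)

lemma integral_comp_perm [IsProbabilityMeasure μ] (hπ : ∀ j σ, MeasurableSet {ω | π j ω = σ})
    (hunif : ∀ j σ, μ.real {ω | π j ω = σ} = 1 / (D ! : ℝ)) (j : ℕ)
    (G : Equiv.Perm (Fin D) → ℝ) :
    ∫ ω, G (π j ω) ∂μ = 1 / (D ! : ℝ) * ∑ σ, G σ := by
  have hsum : ∀ ω, G (π j ω) = ∑ σ, Set.indicator {ω | π j ω = σ} (fun _ => G σ) ω := fun ω => by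
    simp [Set.indicator_apply]
  simp only [hsum]
  rw [integral_finsetSum _ fun σ _ => (integrable_const _).indicator (hπ j σ), Finset.mul_sum]
  refine Finset.sum_congr rfl fun σ _ => ?_
  rw [integral_indicator_const _ (hπ j σ), hunif, smul_eq_mul]

/-- Induction on k: split according to the cell of the last permutation, which is independent of the
counts of the earlier ones. This reproduces the recursion defining `trinomialExp`. -/
lemma integral_hashCounts_eq_trinomialExp [IsProbabilityMeasure μ] {S₁ S₂ : Finset (Fin D)}
    (hne : (S₁ ∪ S₂).Nonempty) {f₁ f₂ a : ℝ}
    (hf₁ : f₁ = S₁.card) (hf₂ : f₂ = S₂.card) (ha : a = (S₁ ∩ S₂).card)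
    (hπ : ∀ j σ, MeasurableSet {ω | π j ω = σ})
    (hunif : ∀ j σ, μ.real {ω | π j ω = σ} = 1 / (D ! : ℝ))
    (hindep : iIndepFun (m := fun _ => (⊤ : MeasurableSpace (Equiv.Perm (Fin D)))) π μ)
    (k : ℕ) (F : ℕ × ℕ × ℕ → ℝ) :
    ∫ ω, F (hashCounts S₁ S₂ k (fun j => π j ω)) ∂μ =
      trinomialExp (cellEq f₁ f₂ a) (cellLt f₁ f₂ a) (cellGt f₁ f₂ a) k F := by
  induction k generalizing F with
  | zero => simp [hashCounts_eq_sum, trinomialExp]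
  | succ k ih =>
    have hstep : iIndepFun (fun j ω => hashStep S₁ S₂ (π j ω)) μ :=
      hindep.comp (fun _ => hashStep S₁ S₂) fun _ => measurable_from_top
    have hind : IndepFun (fun ω => hashCounts S₁ S₂ k (fun j => π j ω))
        (fun ω => hashStep S₁ S₂ (π k ω)) μ := by
      have := hstep.indepFun_finsetSum_of_notMem (measurable_hashStep_comp S₁ S₂ hπ)
        (Finset.notMem_range_self (n := k))
      convert this using 1
      funext ω
      simp [hashCounts_eq_sum]
    have hprod : ∀ c : ℕ × ℕ × ℕ,
        ∫ ω, F (hashCounts S₁ S₂ k (fun j => π j ω) + c) *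
            (if hashStep S₁ S₂ (π k ω) = c then 1 else 0) ∂μ =
          trinomialExp (cellEq f₁ f₂ a) (cellLt f₁ f₂ a) (cellGt f₁ f₂ a) k
            (fun n => F (n + c)) *
          ∫ ω, (if hashStep S₁ S₂ (π k ω) = c then (1 : ℝ) else 0) ∂μ := fun c => by
      rw [← ih]
      have hc := hind.comp (measurable_of_countable fun n => F (n + c))
        (measurable_of_countable fun n => if n = c then (1 : ℝ) else 0)
      exact hc.integral_fun_mul_eq_mul_integral
        (integrable_comp_hashCounts hne hπ k fun n => F (n + c)).aestronglyMeasurable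
        ((measurable_of_countable fun n => if n = c then (1 : ℝ) else 0).comp
          (measurable_hashStep_comp S₁ S₂ hπ k)).aestronglyMeasurable
    have hcell : ∀ c : ℕ × ℕ × ℕ, ∫ ω, (if hashStep S₁ S₂ (π k ω) = c then (1 : ℝ) else 0) ∂μ =
        cellEq f₁ f₂ a * (if (1, 0, 0) = c then 1 else 0) +
        cellLt f₁ f₂ a * (if (0, 1, 0) = c then 1 else 0) +
        cellGt f₁ f₂ a * (if (0, 0, 1) = c then 1 else 0) := fun c => by
      rw [integral_comp_perm hπ hunif k fun σ => if hashStep S₁ S₂ σ = c then (1 : ℝ) else 0]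
      exact average_hashStep S₁ S₂ hne hf₁ hf₂ ha fun n => if n = c then 1 else 0
    have hsplit : ∀ ω, F (hashCounts S₁ S₂ (k + 1) (fun j => π j ω)) =
        F (hashCounts S₁ S₂ k (fun j => π j ω) + (1, 0, 0)) *
          (if hashStep S₁ S₂ (π k ω) = (1, 0, 0) then 1 else 0) +
        F (hashCounts S₁ S₂ k (fun j => π j ω) + (0, 1, 0)) *
          (if hashStep S₁ S₂ (π k ω) = (0, 1, 0) then 1 else 0) +
        F (hashCounts S₁ S₂ k (fun j => π j ω) + (0, 0, 1)) *
          (if hashStep S₁ S₂ (π k ω) = (0, 0, 1) then 1 else 0) := fun ω => by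
      rw [hashCounts_eq_sum, Finset.sum_range_succ, ← hashCounts_eq_sum]
      rcases hashStep_cases S₁ S₂ hne (π k ω) with ⟨-, h⟩ | ⟨-, h⟩ | ⟨-, h⟩ <;> simp [h]
    have hint : ∀ c : ℕ × ℕ × ℕ, Integrable (fun ω =>
        F (hashCounts S₁ S₂ k (fun j => π j ω) + c) *
          (if hashStep S₁ S₂ (π k ω) = c then 1 else 0)) μ := fun c => by
      refine (integrable_comp_hashCounts hne hπ k fun n => F (n + c)).mul_bdd (c := 1)
        ((measurable_of_countable fun n => if n = c then (1 : ℝ) else 0).comp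
          (measurable_hashStep_comp S₁ S₂ hπ k)).aestronglyMeasurable (ae_of_all _ fun ω => ?_)
      by_cases h : hashStep S₁ S₂ (π k ω) = c <;> simp [h]
    simp only [hsplit]
    have hadd := integral_add ((hint (1, 0, 0)).add (hint (0, 1, 0))) (hint (0, 0, 1))
    simp only [Pi.add_apply] at hadd
    rw [hadd, integral_add (hint _) (hint _), hprod, hprod, hprod, hcell, hcell, hcell]
    simp [trinomialExp]
    ring

lemma measure_hashCounts [IsProbabilityMeasure μ] {S₁ S₂ : Finset (Fin D)}
    (hne : (S₁ ∪ S₂).Nonempty) {f₁ f₂ a : ℝ}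
    (hf₁ : f₁ = S₁.card) (hf₂ : f₂ = S₂.card) (ha : a = (S₁ ∩ S₂).card)
    (hπ : ∀ j σ, MeasurableSet {ω | π j ω = σ})
    (hunif : ∀ j σ, μ.real {ω | π j ω = σ} = 1 / (D ! : ℝ))
    (hindep : iIndepFun (m := fun _ => (⊤ : MeasurableSpace (Equiv.Perm (Fin D)))) π μ)
    (k : ℕ) (P : ℕ × ℕ × ℕ → Prop) [DecidablePred P] :
    μ.real {ω | P (hashCounts S₁ S₂ k (fun j => π j ω))} =
      trinomialExp (cellEq f₁ f₂ a) (cellLt f₁ f₂ a) (cellGt f₁ f₂ a) k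
        (fun n => if P n then 1 else 0) := by
  have hmeas : MeasurableSet {ω | P (hashCounts S₁ S₂ k (fun j => π j ω))} :=
    measurable_hashCounts S₁ S₂ hπ k (MeasurableSet.of_discrete (s := {n | P n}))
  rw [← integral_hashCounts_eq_trinomialExp hne hf₁ hf₂ ha hπ hunif hindep,
    ← integral_indicator_one hmeas]
  simp [Set.indicator_apply]

end Counts

/-! ### Expansion of the estimation error in the frequency deviations. -/

section Expansion

/-- Inversion of `B h = u + h v + c h² + h² w + e` for small `h`, to first and to second order. -/
lemma isBigO_quadratic_inversion {ι : Type*} {l : Filter ι} {h u v w e N : ι → ℝ} {B c : ℝ}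
    (hB : B ≠ 0) (hh : h =O[l] N) (hu : u =O[l] N) (hv : v =O[l] N) (hw : w =O[l] N)
    (he : e =O[l] fun n => N n ^ 3) (hN : N =O[l] fun _ => (1 : ℝ))
    (heq : ∀ n, B * h n = u n + h n * v n + c * h n ^ 2 + h n ^ 2 * w n + e n) :
    ((fun n => B * h n - u n) =O[l] fun n => N n ^ 2) ∧
    ((fun n => B ^ 2 * h n ^ 2 - u n ^ 2 - 2 / B * (u n ^ 2 * v n) - 2 * c / B ^ 2 * u n ^ 3)
      =O[l] fun n => N n ^ 4) := by
  have h32 : (fun n => N n ^ 3) =O[l] fun n => N n ^ 2 := by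
    simpa only [pow_succ _ 2, mul_one] using (isBigO_refl (fun n => N n ^ 2) l).mul hN
  have hhv : (fun n => h n * v n) =O[l] fun n => N n ^ 2 := by
    simpa [sq] using hh.mul hv
  have hh2 : (fun n => h n ^ 2) =O[l] fun n => N n ^ 2 := hh.pow 2
  have hhw : (fun n => h n ^ 2 * w n) =O[l] fun n => N n ^ 3 := by
    simpa [pow_succ] using hh2.mul hw
  have hr : (fun n => B * h n - u n) =O[l] fun n => N n ^ 2 := by
    have := ((hhv.add (hh2.const_mul_left c)).add (hhw.trans h32)).add (he.trans h32)
    refine this.congr_left fun n => ?_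
    rw [heq]
    ring
  refine ⟨hr, ?_⟩
  -- With d = B h - u, one has B² h² = u² + 2 u d + d². Here `t1` and `t2` are the errors of
  -- replacing h by u/B in h v and c h², so d = u v/B + c u²/B² + O(N³), and multiplying by 2 u
  -- gains one more order.
  have t1 : (fun n => B⁻¹ * ((B * h n - u n) * v n)) =O[l] fun n => N n ^ 3 := by
    simpa [pow_succ] using (hr.mul hv).const_mul_left B⁻¹
  have t2 : (fun n => c * B⁻¹ * ((B * h n - u n) * (h n + B⁻¹ * u n))) =O[l] fun n => N n ^ 3 := by
    simpa [pow_succ] using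
      (hr.mul (hh.add (hu.const_mul_left B⁻¹))).const_mul_left (c * B⁻¹)
  have t3 : (fun n => 2 * (u n * (B⁻¹ * ((B * h n - u n) * v n) +
      c * B⁻¹ * ((B * h n - u n) * (h n + B⁻¹ * u n)) + h n ^ 2 * w n + e n)))
      =O[l] fun n => N n ^ 4 := by
    refine ((hu.mul (((t1.add t2).add hhw).add he)).const_mul_left 2).congr_right fun n => ?_
    ring
  have t4 : (fun n => (B * h n - u n) ^ 2) =O[l] fun n => N n ^ 4 := by
    refine (hr.pow 2).congr_right fun n => ?_
    ring
  refine (t3.add t4).congr_left fun n => ?_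
  obtain ⟨d, hd⟩ : ∃ d, d = B * h n - u n := ⟨_, rfl⟩
  have hd' : d = h n * v n + c * h n ^ 2 + h n ^ 2 * w n + e n := by rw [hd, heq]; ring
  have hhd : h n = B⁻¹ * (u n + d) := by rw [hd]; field_simp; ring
  have h1 : B⁻¹ * (d * v n) + c * B⁻¹ * (d * (h n + B⁻¹ * u n)) + h n ^ 2 * w n + e n =
      d - B⁻¹ * (u n * v n) - c * B⁻¹ ^ 2 * u n ^ 2 := by
    conv_rhs => rw [hd']
    rw [hhd]
    ring
  rw [← hd, h1, hhd]
  field_simp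
  ring

/-- The total deviation of the observed cell frequencies from `p`, `q`, `r`. -/
noncomputable def totalDev (p q r : ℝ) (n : ℕ × ℕ × ℕ) : ℝ :=
  |n.1 / trials n - p| + |n.2.1 / trials n - q| + |n.2.2 / trials n - r|

lemma totalDev_nonneg (p q r : ℝ) (n : ℕ × ℕ × ℕ) : 0 ≤ totalDev p q r n := by
  unfold totalDev
  positivity

lemma freq_sum {n : ℕ × ℕ × ℕ} (hn : 0 < trials n) :
    (n.1 : ℝ) / trials n + n.2.1 / trials n + n.2.2 / trials n = 1 := by
  have : (trials n : ℝ) ≠ 0 := by exact_mod_cast hn.ne'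
  rw [← add_div, ← add_div, div_eq_one_iff_eq this]
  simp [trials]

lemma totalDev_le {p q r : ℝ} (hp : 0 ≤ p) (hq : 0 ≤ q) (hr : 0 ≤ r) (hs : p + q + r = 1)
    {n : ℕ × ℕ × ℕ} (hn : 0 < trials n) : totalDev p q r n ≤ 2 := by
  have hf := freq_sum hn
  have h1 : 0 ≤ (n.1 : ℝ) / trials n := by positivity
  have h2 : 0 ≤ (n.2.1 : ℝ) / trials n := by positivity
  have h3 : 0 ≤ (n.2.2 : ℝ) / trials n := by positivity
  have habs : ∀ x y : ℝ, 0 ≤ x → 0 ≤ y → |x - y| ≤ x + y := fun x y hx hy => by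
    rw [abs_le]; constructor <;> linarith
  unfold totalDev
  linarith [habs _ _ h1 hp, habs _ _ h2 hq, habs _ _ h3 hr]

lemma devForm_isBigO (p q r α β γ : ℝ) (l : Filter (ℕ × ℕ × ℕ)) :
    devForm p q r α β γ =O[l] totalDev p q r := by
  refine IsBigO.of_bound (|α| + |β| + |γ|) (Eventually.of_forall fun n => ?_)
  rw [Real.norm_eq_abs, Real.norm_of_nonneg (totalDev_nonneg _ _ _ _)]
  unfold devForm totalDev
  have h1 := abs_nonneg ((n.1 : ℝ) / trials n - p)
  have h2 := abs_nonneg ((n.2.1 : ℝ) / trials n - q)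
  have h3 := abs_nonneg ((n.2.2 : ℝ) / trials n - r)
  refine (abs_add_three _ _ _).trans ?_
  rw [abs_mul, abs_mul, abs_mul]
  nlinarith [abs_nonneg α, abs_nonneg β, abs_nonneg γ, mul_nonneg (abs_nonneg α) h2,
    mul_nonneg (abs_nonneg α) h3, mul_nonneg (abs_nonneg β) h1, mul_nonneg (abs_nonneg β) h3,
    mul_nonneg (abs_nonneg γ) h1, mul_nonneg (abs_nonneg γ) h2]

/-- An empty cell has frequency zero and so deviates by its whole probability. -/
lemma le_totalDev_of_zero {p q r δ : ℝ} (hp : δ ≤ p) (hq : δ ≤ q) (hr : δ ≤ r) {n : ℕ × ℕ × ℕ}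
    (h : ¬(0 < n.1 ∧ 0 < n.2.1 ∧ 0 < n.2.2)) : δ ≤ totalDev p q r n := by
  have h1 := abs_nonneg ((n.1 : ℝ) / trials n - p)
  have h2 := abs_nonneg ((n.2.1 : ℝ) / trials n - q)
  have h3 := abs_nonneg ((n.2.2 : ℝ) / trials n - r)
  have h4 : n.1 = 0 ∨ n.2.1 = 0 ∨ n.2.2 = 0 := by omega
  unfold totalDev
  rcases h4 with h | h | h
  · have : δ ≤ |(n.1 : ℝ) / trials n - p| := by
      rw [h]; simpa using hp.trans (le_abs_self p)
    linarith
  · have : δ ≤ |(n.2.1 : ℝ) / trials n - q| := by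
      rw [h]; simpa using hq.trans (le_abs_self q)
    linarith
  · have : δ ≤ |(n.2.2 : ℝ) / trials n - r| := by
      rw [h]; simpa using hr.trans (le_abs_self r)
    linarith

/-- A bounded function that vanishes when no cell is empty is of every order in the deviation. -/
lemma isBigO_totalDev_pow_of_zero {p q r : ℝ} (hp : 0 < p) (hq : 0 < q) (hr : 0 < r)
    {e : ℕ × ℕ × ℕ → ℝ} {s : Set (ℕ × ℕ × ℕ)} (he : e =O[𝓟 s] fun _ => (1 : ℝ))
    (hz : ∀ n ∈ s, 0 < n.1 ∧ 0 < n.2.1 ∧ 0 < n.2.2 → e n = 0) (i : ℕ) :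
    e =O[𝓟 s] fun n => totalDev p q r n ^ i := by
  obtain ⟨C, hC0, hC⟩ := he.exists_nonneg
  rw [isBigOWith_principal] at hC
  have hδ : 0 < min p (min q r) := lt_min hp (lt_min hq hr)
  refine IsBigO.of_bound (C / min p (min q r) ^ i) (eventually_principal.2 fun n hn => ?_)
  rw [Real.norm_of_nonneg (pow_nonneg (totalDev_nonneg _ _ _ _) _)]
  by_cases hpos : 0 < n.1 ∧ 0 < n.2.1 ∧ 0 < n.2.2
  · rw [hz n hn hpos, norm_zero]
    have := totalDev_nonneg p q r n
    positivity
  · have hle := le_totalDev_of_zero (min_le_left _ _) ((min_le_right _ _).trans (min_le_left _ _))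
      ((min_le_right _ _).trans (min_le_right _ _)) hpos (p := p) (q := q) (r := r)
    have hle' := pow_le_pow_left₀ hδ.le hle i
    refine (hC n hn).trans ?_
    rw [norm_one, mul_one, div_mul_eq_mul_div, le_div_iff₀ (by positivity)]
    exact mul_le_mul_of_nonneg_left hle' hC0

variable {f₁ f₂ a : ℝ}

/-- The Fisher information at `a`, multiplied by `(f₁ + f₂ - a) ^ 2`. -/
noncomputable def scoreSlope (f₁ f₂ a : ℝ) : ℝ :=
  (f₁ + f₂) / a + f₂ / (f₁ - a) + f₁ / (f₂ - a)

lemma scoreSlope_pos (ha : 0 < a) (ha₁ : a < f₁) (ha₂ : a < f₂) : 0 < scoreSlope f₁ f₂ a := by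
  have h1 : 0 < f₁ - a := sub_pos.2 ha₁
  have h2 : 0 < f₂ - a := sub_pos.2 ha₂
  have h3 : 0 < f₁ := ha.trans ha₁
  have h4 : 0 < f₂ := ha.trans ha₂
  unfold scoreSlope
  positivity

/-- The likelihood equation for frequencies that deviate by `x`, `y`, `z` from the cell
probabilities at `a`, as a quadratic equation in the estimation error `t - a`. -/
lemma likelihood_equation_quadratic (ha : 0 < a) (ha₁ : a < f₁) (ha₂ : a < f₂) {t x y z : ℝ}
    (ht0 : t ≠ 0) (ht₁ : f₁ - t ≠ 0) (ht₂ : f₂ - t ≠ 0)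
    (h : (x + cellEq f₁ f₂ a) * ((f₁ + f₂) / t) - (y + cellLt f₁ f₂ a) * (f₂ / (f₁ - t)) -
      (z + cellGt f₁ f₂ a) * (f₁ / (f₂ - t)) = 0) :
    scoreSlope f₁ f₂ a / (f₁ + f₂ - a) * (t - a) =
      ((f₁ + f₂) / a * x + -(f₂ / (f₁ - a)) * y + -(f₁ / (f₂ - a)) * z) +
      (t - a) * (-((f₁ + f₂) * (f₁ + f₂ - 2 * a)) / (a * (f₁ - a) * (f₂ - a)) * x +
        -(f₂ * (f₂ - 2 * a)) / (a * (f₁ - a) * (f₂ - a)) * y +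
        -(f₁ * (f₁ - 2 * a)) / (a * (f₁ - a) * (f₂ - a)) * z) +
      ((f₁ + f₂) * cellEq f₁ f₂ a + f₂ * cellLt f₁ f₂ a + f₁ * cellGt f₁ f₂ a) /
        (a * (f₁ - a) * (f₂ - a)) * (t - a) ^ 2 +
      (t - a) ^ 2 * ((f₁ + f₂) / (a * (f₁ - a) * (f₂ - a)) * x +
        f₂ / (a * (f₁ - a) * (f₂ - a)) * y + f₁ / (a * (f₁ - a) * (f₂ - a)) * z) := by
  have h1 : f₁ - a ≠ 0 := (sub_pos.2 ha₁).ne'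
  have h2 : f₂ - a ≠ 0 := (sub_pos.2 ha₂).ne'
  have h3 : f₁ + f₂ - a ≠ 0 := by linarith
  -- Clearing denominators leaves a polynomial of degree at most two in t, so its expansion around a
  -- is exact.
  have hpoly : (x + cellEq f₁ f₂ a) * (f₁ + f₂) * (f₁ - t) * (f₂ - t) -
      (y + cellLt f₁ f₂ a) * f₂ * t * (f₂ - t) - (z + cellGt f₁ f₂ a) * f₁ * t * (f₁ - t) = 0 := by
    have : (t * (f₁ - t) * (f₂ - t)) * ((x + cellEq f₁ f₂ a) * ((f₁ + f₂) / t) -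
        (y + cellLt f₁ f₂ a) * (f₂ / (f₁ - t)) - (z + cellGt f₁ f₂ a) * (f₁ / (f₂ - t))) = 0 := by
      rw [h, mul_zero]
    rw [← this]
    field_simp
  rw [← sub_eq_zero, ← mul_zero (-(a * (f₁ - a) * (f₂ - a))⁻¹), ← hpoly]
  unfold scoreSlope cellEq cellLt cellGt
  field_simp
  ring

lemma mleEquation_freq {n : ℕ × ℕ × ℕ} {t : ℝ}
    (h : MLEEquation f₁ f₂ n.1 n.2.1 n.2.2 t) :
    (n.1 : ℝ) / trials n * ((f₁ + f₂) / t) - (n.2.1 : ℝ) / trials n * (f₂ / (f₁ - t)) -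
      (n.2.2 : ℝ) / trials n * (f₁ / (f₂ - t)) = 0 := by
  unfold MLEEquation at h
  linear_combination (trials n : ℝ)⁻¹ * h

lemma cell_score_eq_zero (ha : 0 < a) (ha₁ : a < f₁) (ha₂ : a < f₂) :
    cellEq f₁ f₂ a * ((f₁ + f₂) / a) - cellLt f₁ f₂ a * (f₂ / (f₁ - a)) -
      cellGt f₁ f₂ a * (f₁ / (f₂ - a)) = 0 := by
  have h1 : f₁ - a ≠ 0 := (sub_pos.2 ha₁).ne'
  have h2 : f₂ - a ≠ 0 := (sub_pos.2 ha₂).ne'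
  have h3 : f₁ + f₂ - a ≠ 0 := by linarith
  unfold cellEq cellLt cellGt
  field_simp
  ring

/-- This is the information identity: the second moment of the one-trial score u equals its slope,
up to the factor f₁ + f₂ - a carried by B. -/
lemma cell_score_sq (ha : 0 < a) (ha₁ : a < f₁) (ha₂ : a < f₂) :
    cellEq f₁ f₂ a * ((f₁ + f₂) / a) ^ 2 + cellLt f₁ f₂ a * (-(f₂ / (f₁ - a))) ^ 2 +
      cellGt f₁ f₂ a * (-(f₁ / (f₂ - a))) ^ 2 = scoreSlope f₁ f₂ a := by
  have h1 : f₁ - a ≠ 0 := (sub_pos.2 ha₁).ne'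
  have h2 : f₂ - a ≠ 0 := (sub_pos.2 ha₂).ne'
  have h3 : f₁ + f₂ - a ≠ 0 := by linarith
  unfold cellEq cellLt cellGt scoreSlope
  field_simp
  ring

/-- The estimation error is controlled by the score at the true parameter. -/
lemma abs_sub_le_score (ha : 0 < a) (ha₁ : a < f₁) (ha₂ : a < f₂) {n : ℕ × ℕ × ℕ} {t : ℝ}
    (hn : 0 < trials n) (ht : t ∈ Set.Ioo 0 (min f₁ f₂))
    (h : MLEEquation f₁ f₂ n.1 n.2.1 n.2.2 t) :
    min f₁ f₂ / (f₁ + f₂) ^ 2 * |t - a| ≤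
      |devForm (cellEq f₁ f₂ a) (cellLt f₁ f₂ a) (cellGt f₁ f₂ a)
        ((f₁ + f₂) / a) (-(f₂ / (f₁ - a))) (-(f₁ / (f₂ - a))) n| := by
  have t0 := ht.1
  have t1 := sub_pos.2 (ht.2.trans_le (min_le_left _ _))
  have t2 := sub_pos.2 (ht.2.trans_le (min_le_right _ _))
  have h1 := sub_pos.2 ha₁
  have h2 := sub_pos.2 ha₂
  have hf₁ : 0 < f₁ := ha.trans ha₁
  have hf₂ : 0 < f₂ := ha.trans ha₂
  have hm : 0 < min f₁ f₂ := lt_min hf₁ hf₂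
  have hf := freq_sum hn
  have hq := mleEquation_freq h
  have hz := cell_score_eq_zero ha ha₁ ha₂
  unfold devForm
  have p1 : 0 ≤ (n.1 : ℝ) / trials n := by positivity
  have p2 : 0 ≤ (n.2.1 : ℝ) / trials n := by positivity
  have p3 : 0 ≤ (n.2.2 : ℝ) / trials n := by positivity
  generalize (n.1 : ℝ) / trials n = x at *
  generalize (n.2.1 : ℝ) / trials n = y at *
  generalize (n.2.2 : ℝ) / trials n = z at *
  -- The score at a is the difference of the empirical left sides at a and at t, the latter being
  -- zero; every difference of reciprocals contains the factor t - a.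
  have key : (f₁ + f₂) / a * (x - cellEq f₁ f₂ a) + -(f₂ / (f₁ - a)) * (y - cellLt f₁ f₂ a) +
      -(f₁ / (f₂ - a)) * (z - cellGt f₁ f₂ a) =
      (x * ((f₁ + f₂) / (a * t)) + y * (f₂ / ((f₁ - a) * (f₁ - t))) +
        z * (f₁ / ((f₂ - a) * (f₂ - t)))) * (t - a) := by
    have : (f₁ + f₂) / a * (x - cellEq f₁ f₂ a) + -(f₂ / (f₁ - a)) * (y - cellLt f₁ f₂ a) +
        -(f₁ / (f₂ - a)) * (z - cellGt f₁ f₂ a) =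
        (x * ((f₁ + f₂) / a) - y * (f₂ / (f₁ - a)) - z * (f₁ / (f₂ - a))) -
        (x * ((f₁ + f₂) / t) - y * (f₂ / (f₁ - t)) - z * (f₁ / (f₂ - t))) := by
      linear_combination -hz + hq
    rw [this]
    field_simp
    ring
  -- The coefficient of t - a is an average of three slopes weighted by the frequencies, so a common
  -- lower bound for the slopes suffices.
  have bound : ∀ c u v : ℝ, min f₁ f₂ ≤ c → 0 < u → 0 < v → u ≤ f₁ + f₂ → v ≤ f₁ + f₂ →
      min f₁ f₂ / (f₁ + f₂) ^ 2 ≤ c / (u * v) := fun c u v hc hu hv hu' hv' => by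
    rw [sq]
    exact div_le_div₀ (hm.le.trans hc) hc (mul_pos hu hv) (mul_le_mul hu' hv' hv.le (by positivity))
  have b1 := bound (f₁ + f₂) a t (by linarith [min_le_left f₁ f₂]) ha t0 (by linarith) (by linarith)
  have b2 := bound f₂ (f₁ - a) (f₁ - t) (min_le_right _ _) h1 t1 (by linarith) (by linarith)
  have b3 := bound f₁ (f₂ - a) (f₂ - t) (min_le_left _ _) h2 t2 (by linarith) (by linarith)
  rw [key, abs_mul]
  refine mul_le_mul_of_nonneg_right ((le_abs_self _).trans' ?_) (abs_nonneg _)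
  calc min f₁ f₂ / (f₁ + f₂) ^ 2 = x * (min f₁ f₂ / (f₁ + f₂) ^ 2) +
        y * (min f₁ f₂ / (f₁ + f₂) ^ 2) + z * (min f₁ f₂ / (f₁ + f₂) ^ 2) := by
        rw [← add_mul, ← add_mul, hf, one_mul]
    _ ≤ _ := by gcongr

lemma mle_error_isBigO_one (ha : 0 < a) (ha₁ : a < f₁) {A : ℕ × ℕ × ℕ → ℝ}
    (hA : ∀ n, 0 < trials n → IsMLE f₁ f₂ n.1 n.2.1 n.2.2 (A n)) :
    (fun n => A n - a) =O[𝓟 {n | 0 < trials n}] fun _ => (1 : ℝ) := by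
  refine IsBigO.of_bound f₁ (eventually_principal.2 fun n hn => ?_)
  obtain ⟨h0, h1⟩ := (hA n hn).1
  have := h1.trans (min_le_left _ _)
  rw [norm_one, mul_one, Real.norm_eq_abs, abs_le]
  constructor <;> linarith

lemma mle_error_isBigO (ha : 0 < a) (ha₁ : a < f₁) (ha₂ : a < f₂) {A : ℕ × ℕ × ℕ → ℝ}
    (hA : ∀ n, 0 < trials n → IsMLE f₁ f₂ n.1 n.2.1 n.2.2 (A n)) :
    (fun n => A n - a) =O[𝓟 {n | 0 < trials n}]
      totalDev (cellEq f₁ f₂ a) (cellLt f₁ f₂ a) (cellGt f₁ f₂ a) := by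
  have hf₁ : 0 < f₁ := ha.trans ha₁
  have hf₂ : 0 < f₂ := ha.trans ha₂
  have hm : 0 < min f₁ f₂ / (f₁ + f₂) ^ 2 := div_pos (lt_min hf₁ hf₂) (by positivity)
  obtain ⟨hp, hq, hr⟩ := cell_pos ⟨ha, lt_min ha₁ ha₂⟩
  classical
  -- `e` isolates the outcomes with an empty cell, where the likelihood equation may fail.
  let e : ℕ × ℕ × ℕ → ℝ := fun n => if 0 < n.1 ∧ 0 < n.2.1 ∧ 0 < n.2.2 then 0 else A n - a
  have he : e =O[𝓟 {n | 0 < trials n}] fun _ => (1 : ℝ) := by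
    refine IsBigO.trans (isBigO_of_le _ fun n => ?_) (mle_error_isBigO_one ha ha₁ hA)
    by_cases h : 0 < n.1 ∧ 0 < n.2.1 ∧ 0 < n.2.2 <;> simp [e, h]
  have he1 := isBigO_totalDev_pow_of_zero hp hq hr he (fun n _ h => if_pos h) 1
  simp only [pow_one] at he1
  have hg : (fun n => A n - a - e n) =O[𝓟 {n | 0 < trials n}]
      devForm (cellEq f₁ f₂ a) (cellLt f₁ f₂ a) (cellGt f₁ f₂ a)
        ((f₁ + f₂) / a) (-(f₂ / (f₁ - a))) (-(f₁ / (f₂ - a))) := by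
    refine IsBigO.of_bound (min f₁ f₂ / (f₁ + f₂) ^ 2)⁻¹ (eventually_principal.2 fun n hn => ?_)
    by_cases h : 0 < n.1 ∧ 0 < n.2.1 ∧ 0 < n.2.2
    · have hmem := (hA n hn).mem_Ioo hf₁ hf₂ h.1 h.2.1 h.2.2
      have := abs_sub_le_score ha ha₁ ha₂ hn hmem ((hA n hn).mleEquation hmem)
      rw [inv_mul_eq_div, le_div_iff₀ hm]
      simp only [e, if_pos h, sub_zero, Real.norm_eq_abs]
      linarith
    · simp only [e, if_neg h, sub_self, norm_zero]
      positivity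
  refine ((hg.trans (devForm_isBigO _ _ _ _ _ _ _)).add he1).congr_left fun n => ?_
  ring

/-- First and second order expansion of the estimation error in the deviations of the observed
frequencies. -/
lemma mle_error_expansion (ha : 0 < a) (ha₁ : a < f₁) (ha₂ : a < f₂) {A : ℕ × ℕ × ℕ → ℝ}
    (hA : ∀ n, 0 < trials n → IsMLE f₁ f₂ n.1 n.2.1 n.2.2 (A n))
    {u : ℕ × ℕ × ℕ → ℝ} {B : ℝ} (hB : B = scoreSlope f₁ f₂ a / (f₁ + f₂ - a))
    (hu : u = devForm (cellEq f₁ f₂ a) (cellLt f₁ f₂ a) (cellGt f₁ f₂ a)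
        ((f₁ + f₂) / a) (-(f₂ / (f₁ - a))) (-(f₁ / (f₂ - a)))) :
    ((fun n => B * (A n - a) - u n) =O[𝓟 {n | 0 < trials n}]
      fun n => totalDev (cellEq f₁ f₂ a) (cellLt f₁ f₂ a) (cellGt f₁ f₂ a) n ^ 2) ∧
    ∃ α β γ c d : ℝ,
    (fun n => B ^ 2 * (A n - a) ^ 2 - u n ^ 2 - c * (u n ^ 2 *
        devForm (cellEq f₁ f₂ a) (cellLt f₁ f₂ a) (cellGt f₁ f₂ a) α β γ n) - d * u n ^ 3)
      =O[𝓟 {n | 0 < trials n}]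
      fun n => totalDev (cellEq f₁ f₂ a) (cellLt f₁ f₂ a) (cellGt f₁ f₂ a) n ^ 4 := by
  have hf₁ : 0 < f₁ := ha.trans ha₁
  have hf₂ : 0 < f₂ := ha.trans ha₂
  obtain ⟨hp, hq, hr⟩ := cell_pos ⟨ha, lt_min ha₁ ha₂⟩
  have hs := cell_sum (f₁ := f₁) (f₂ := f₂) (t := a) (by linarith)
  have hB0 : B ≠ 0 := by
    rw [hB]
    exact (div_pos (scoreSlope_pos ha ha₁ ha₂) (by linarith)).ne'
  set W := a * (f₁ - a) * (f₂ - a) with hW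
  obtain ⟨v, hv⟩ : ∃ v, v = devForm (cellEq f₁ f₂ a) (cellLt f₁ f₂ a) (cellGt f₁ f₂ a)
    (-((f₁ + f₂) * (f₁ + f₂ - 2 * a)) / W) (-(f₂ * (f₂ - 2 * a)) / W)
    (-(f₁ * (f₁ - 2 * a)) / W) := ⟨_, rfl⟩
  obtain ⟨w, hw⟩ : ∃ w, w = devForm (cellEq f₁ f₂ a) (cellLt f₁ f₂ a) (cellGt f₁ f₂ a)
    ((f₁ + f₂) / W) (f₂ / W) (f₁ / W) := ⟨_, rfl⟩
  obtain ⟨c, hc⟩ : ∃ c, c =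
    ((f₁ + f₂) * cellEq f₁ f₂ a + f₂ * cellLt f₁ f₂ a + f₁ * cellGt f₁ f₂ a) / W := ⟨_, rfl⟩
  have hN : totalDev (cellEq f₁ f₂ a) (cellLt f₁ f₂ a) (cellGt f₁ f₂ a)
      =O[𝓟 {n | 0 < trials n}] fun _ => (1 : ℝ) := by
    refine IsBigO.of_bound 2 (eventually_principal.2 fun n hn => ?_)
    rw [Real.norm_of_nonneg (totalDev_nonneg _ _ _ _)]
    simpa using totalDev_le hp.le hq.le hr.le hs hn
  have hh := mle_error_isBigO ha ha₁ ha₂ hA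
  have huN : u =O[𝓟 {n | 0 < trials n}] _ := hu ▸ devForm_isBigO _ _ _ _ _ _ _
  have hvN : v =O[𝓟 {n | 0 < trials n}] _ := hv ▸ devForm_isBigO _ _ _ _ _ _ _
  have hwN : w =O[𝓟 {n | 0 < trials n}] _ := hw ▸ devForm_isBigO _ _ _ _ _ _ _
  -- The defect of the quadratic equation is bounded, and it is zero unless some cell is empty;
  -- hence it has the third order that the inversion asks for.
  have he : (fun n => B * (A n - a) -
      (u n + (A n - a) * v n + c * (A n - a) ^ 2 + (A n - a) ^ 2 * w n))
      =O[𝓟 {n | 0 < trials n}]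
      fun n => totalDev (cellEq f₁ f₂ a) (cellLt f₁ f₂ a) (cellGt f₁ f₂ a) n ^ 3 := by
    refine isBigO_totalDev_pow_of_zero hp hq hr ?_ (fun n hn hpos => ?_) 3
    · have h1 := hh.trans hN
      have h2 := huN.trans hN
      have h3 := h1.mul (hvN.trans hN)
      have h4 := h1.pow 2
      have h5 := h4.mul (hwN.trans hN)
      simp only [mul_one, one_pow] at h3 h4 h5
      exact (h1.const_mul_left B).sub (((h2.add h3).add (h4.const_mul_left c)).add h5)
    · have hmem := (hA n hn).mem_Ioo hf₁ hf₂ hpos.1 hpos.2.1 hpos.2.2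
      have t0 := hmem.1.ne'
      have t1 := (sub_pos.2 (hmem.2.trans_le (min_le_left _ _))).ne'
      have t2 := (sub_pos.2 (hmem.2.trans_le (min_le_right _ _))).ne'
      have hq := mleEquation_freq ((hA n hn).mleEquation hmem)
      have := likelihood_equation_quadratic ha ha₁ ha₂ t0 t1 t2
        (x := n.1 / trials n - cellEq f₁ f₂ a) (y := n.2.1 / trials n - cellLt f₁ f₂ a)
        (z := n.2.2 / trials n - cellGt f₁ f₂ a) (by simpa only [sub_add_cancel] using hq)
      rw [sub_eq_zero, hB, hu, hv, hw, hc, this]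
      rfl
  obtain ⟨r1, r2⟩ := isBigO_quadratic_inversion (c := c) hB0 hh huN hvN hwN he hN fun n => by ring
  rw [hv] at r2
  exact ⟨r1, _, _, _, _, _, r2⟩

end Expansion

/-! ### Bias and mean square error. -/

section Asymptotics

lemma isBigO_of_forall_pos_abs_le {g : ℕ → ℝ} {b : ℕ → ℝ} {C : ℝ}
    (h : ∀ k, 0 < k → |g k| ≤ C * b k) (hb : ∀ k, 0 ≤ b k) : g =O[atTop] b := by
  refine IsBigO.of_bound C ?_
  filter_upwards [eventually_gt_atTop 0] with k hk
  rw [Real.norm_eq_abs, Real.norm_of_nonneg (hb k)]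
  exact h k hk

section Moments

variable {p q r : ℝ}

lemma exists_trinomialExp_totalDev_sq_le (hp : 0 ≤ p) (hq : 0 ≤ q) (hr : 0 ≤ r)
    (hs : p + q + r = 1) : ∃ C, ∀ k : ℕ, 0 < k →
      trinomialExp p q r k (fun n => totalDev p q r n ^ 2) ≤ C * (1 / (k : ℝ)) := by
  refine ⟨3 * ((p * 1 ^ 2 + q * 0 ^ 2 + r * 0 ^ 2 - (p * 1 + q * 0 + r * 0) ^ 2) +
    (p * 0 ^ 2 + q * 1 ^ 2 + r * 0 ^ 2 - (p * 0 + q * 1 + r * 0) ^ 2) +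
    (p * 0 ^ 2 + q * 0 ^ 2 + r * 1 ^ 2 - (p * 0 + q * 0 + r * 1) ^ 2)), fun k hk => ?_⟩
  refine (trinomialExp_mono hp hq hr (G := fun n => 3 * (devForm p q r 1 0 0 n ^ 2 +
    (devForm p q r 0 1 0 n ^ 2 + devForm p q r 0 0 1 n ^ 2))) fun n _ => ?_).trans_eq ?_
  · simp only [devForm, totalDev, one_mul, zero_mul, add_zero, zero_add]
    rw [← sq_abs ((n.1 : ℝ) / trials n - p), ← sq_abs ((n.2.1 : ℝ) / trials n - q),
      ← sq_abs ((n.2.2 : ℝ) / trials n - r)]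
    generalize |(n.1 : ℝ) / trials n - p| = x
    generalize |(n.2.1 : ℝ) / trials n - q| = y
    generalize |(n.2.2 : ℝ) / trials n - r| = z
    nlinarith [sq_nonneg (x - y), sq_nonneg (x - z), sq_nonneg (y - z)]
  · rw [trinomialExp_mul_left, trinomialExp_add, trinomialExp_add,
      trinomialExp_devForm_sq hp hq hr hs hk, trinomialExp_devForm_sq hp hq hr hs hk,
      trinomialExp_devForm_sq hp hq hr hs hk]
    ring

lemma exists_trinomialExp_totalDev_fourth_le (hp : 0 ≤ p) (hq : 0 ≤ q) (hr : 0 ≤ r)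
    (hs : p + q + r = 1) : ∃ C, ∀ k : ℕ, 0 < k →
      trinomialExp p q r k (fun n => totalDev p q r n ^ 4) ≤ C * (1 / (k : ℝ) ^ 2) := by
  obtain ⟨C₁, h₁⟩ := exists_trinomialExp_devForm_fourth_le hp hq hr hs 1 0 0
  obtain ⟨C₂, h₂⟩ := exists_trinomialExp_devForm_fourth_le hp hq hr hs 0 1 0
  obtain ⟨C₃, h₃⟩ := exists_trinomialExp_devForm_fourth_le hp hq hr hs 0 0 1
  refine ⟨27 * (C₁ + C₂ + C₃), fun k hk => ?_⟩
  -- The constant 27 = 3² · 3 comes from applying (x + y + z)² ≤ 3 (x² + y² + z²) first to the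
  -- deviations and then to their squares.
  refine (trinomialExp_mono hp hq hr (G := fun n => 27 * (devForm p q r 1 0 0 n ^ 4 +
    (devForm p q r 0 1 0 n ^ 4 + devForm p q r 0 0 1 n ^ 4))) fun n _ => ?_).trans ?_
  · simp only [devForm, totalDev, one_mul, zero_mul, add_zero, zero_add]
    have habs : ∀ x : ℝ, x ^ 4 = (|x| ^ 2) ^ 2 := fun x => by rw [sq_abs]; ring
    rw [habs ((n.1 : ℝ) / trials n - p), habs ((n.2.1 : ℝ) / trials n - q),
      habs ((n.2.2 : ℝ) / trials n - r)]
    generalize |(n.1 : ℝ) / trials n - p| = x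
    generalize |(n.2.1 : ℝ) / trials n - q| = y
    generalize |(n.2.2 : ℝ) / trials n - r| = z
    have hsq : (x + y + z) ^ 2 ≤ 3 * (x ^ 2 + y ^ 2 + z ^ 2) := by
      nlinarith [sq_nonneg (x - y), sq_nonneg (x - z), sq_nonneg (y - z)]
    have hsq' : (x ^ 2 + y ^ 2 + z ^ 2) ^ 2 ≤ 3 * ((x ^ 2) ^ 2 + ((y ^ 2) ^ 2 + (z ^ 2) ^ 2)) := by
      nlinarith [sq_nonneg (x ^ 2 - y ^ 2), sq_nonneg (x ^ 2 - z ^ 2), sq_nonneg (y ^ 2 - z ^ 2)]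
    calc (x + y + z) ^ 4 = ((x + y + z) ^ 2) ^ 2 := by ring
      _ ≤ (3 * (x ^ 2 + y ^ 2 + z ^ 2)) ^ 2 := pow_le_pow_left₀ (sq_nonneg _) hsq 2
      _ ≤ _ := by linarith
  · rw [trinomialExp_mul_left, trinomialExp_add, trinomialExp_add]
    linarith [h₁ k hk, h₂ k hk, h₃ k hk]

lemma exists_abs_trinomialExp_devForm_sq_mul_le (hp : 0 ≤ p) (hq : 0 ≤ q) (hr : 0 ≤ r)
    (hs : p + q + r = 1) (α β γ α' β' γ' : ℝ) : ∃ C, ∀ k : ℕ, 0 < k →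
      |trinomialExp p q r k (fun n => devForm p q r α β γ n ^ 2 * devForm p q r α' β' γ' n)| ≤
        C * (1 / (k : ℝ) ^ 2) := by
  obtain ⟨C₁, h₁⟩ := exists_abs_trinomialExp_devForm_cube_le hp hq hr hs (α' + α) (β' + β) (γ' + γ)
  obtain ⟨C₂, h₂⟩ := exists_abs_trinomialExp_devForm_cube_le hp hq hr hs (α' - α) (β' - β) (γ' - γ)
  obtain ⟨C₃, h₃⟩ := exists_abs_trinomialExp_devForm_cube_le hp hq hr hs α' β' γ'
  refine ⟨6⁻¹ * (C₁ + C₂ + 2 * C₃), fun k hk => ?_⟩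
  -- Polarization, 6 u² v = (v + u)³ + (v - u)³ - 2 v³, reduces the mixed moment to pure cubes of
  -- linear forms.
  have hpol : (fun n => devForm p q r α β γ n ^ 2 * devForm p q r α' β' γ' n) = fun n =>
      6⁻¹ * (devForm p q r (α' + α) (β' + β) (γ' + γ) n ^ 3 +
        (devForm p q r (α' - α) (β' - β) (γ' - γ) n ^ 3 + -2 * devForm p q r α' β' γ' n ^ 3)) := by
    funext n
    unfold devForm
    ring
  rw [hpol, trinomialExp_mul_left, trinomialExp_add, trinomialExp_add, trinomialExp_mul_left]
  have h1 := abs_le.1 (h₁ k hk)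
  have h2 := abs_le.1 (h₂ k hk)
  have h3 := abs_le.1 (h₃ k hk)
  rw [abs_le]
  constructor <;> linarith [h1.1, h1.2, h2.1, h2.2, h3.1, h3.2]

/-- Over a principal filter the O-constant is uniform over all outcomes with a positive number of
trials, so it passes through the expectation for every k > 0. -/
lemma isBigO_trinomialExp (hp : 0 ≤ p) (hq : 0 ≤ q) (hr : 0 ≤ r) {F G : ℕ × ℕ × ℕ → ℝ}
    {b : ℕ → ℝ} (hFG : F =O[𝓟 {n | 0 < trials n}] G) (hG : ∀ n, 0 ≤ G n) (hb : ∀ k, 0 ≤ b k)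
    (h : ∃ C, ∀ k : ℕ, 0 < k → trinomialExp p q r k G ≤ C * b k) :
    (fun k => trinomialExp p q r k F) =O[atTop] b := by
  obtain ⟨C, hC⟩ := h
  obtain ⟨C', hC', hF⟩ := hFG.exists_nonneg
  rw [isBigOWith_principal] at hF
  refine isBigO_of_forall_pos_abs_le (C := C' * C) (fun k hk => ?_) hb
  refine (abs_trinomialExp_le (G := fun n => C' * G n) hp hq hr fun n hn => ?_).trans ?_
  · have := hF n (show 0 < trials n by omega)
    rwa [Real.norm_eq_abs, Real.norm_of_nonneg (hG n)] at this
  · rw [trinomialExp_mul_left, mul_assoc]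
    exact mul_le_mul_of_nonneg_left (hC k hk) hC'

end Moments

variable {f₁ f₂ a : ℝ}

/-- The indicator minus one lives on outcomes with an empty cell, hence is O(N²), and E N² = O(1/k).
-/
lemma trinomialExp_all_cells_pos_tendsto {p q r : ℝ} (hp : 0 < p) (hq : 0 < q) (hr : 0 < r)
    (hs : p + q + r = 1) :
    Tendsto (fun k => trinomialExp p q r k
      (fun n => if 0 < n.1 ∧ 0 < n.2.1 ∧ 0 < n.2.2 then 1 else 0)) atTop (𝓝 1) := by
  have hO : (fun n : ℕ × ℕ × ℕ => (if 0 < n.1 ∧ 0 < n.2.1 ∧ 0 < n.2.2 then (1 : ℝ) else 0) - 1)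
      =O[𝓟 {n | 0 < trials n}] fun n => totalDev p q r n ^ 2 := by
    refine isBigO_totalDev_pow_of_zero hp hq hr (isBigO_of_le _ fun n => ?_)
      (fun n _ h => by rw [if_pos h, sub_self]) 2
    by_cases h : 0 < n.1 ∧ 0 < n.2.1 ∧ 0 < n.2.2 <;> simp [h]
  have := isBigO_trinomialExp hp.le hq.le hr.le (b := fun k => 1 / (k : ℝ)) hO
    (fun n => sq_nonneg _) (fun k => by positivity)
    (exists_trinomialExp_totalDev_sq_le hp.le hq.le hr.le hs)
  have h0 := this.trans_tendsto tendsto_one_div_atTop_nhds_zero_nat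
  rw [← tendsto_sub_nhds_zero_iff]
  refine h0.congr fun k => ?_
  have hc := trinomialExp_const hs k (-1)
  have ha := trinomialExp_add (p := p) (q := q) (r := r) k
    (fun n => if 0 < n.1 ∧ 0 < n.2.1 ∧ 0 < n.2.2 then (1 : ℝ) else 0) (fun _ => -1)
  rw [hc] at ha
  simpa only [sub_eq_add_neg] using ha

lemma trinomialExp_mle_error (ha : 0 < a) (ha₁ : a < f₁) (ha₂ : a < f₂) {A : ℕ × ℕ × ℕ → ℝ}
    (hA : ∀ n, 0 < trials n → IsMLE f₁ f₂ n.1 n.2.1 n.2.2 (A n)) :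
    (fun k => trinomialExp (cellEq f₁ f₂ a) (cellLt f₁ f₂ a) (cellGt f₁ f₂ a) k
      (fun n => A n - a)) =O[atTop] fun k : ℕ => 1 / (k : ℝ) := by
  obtain ⟨hp, hq, hr⟩ := cell_pos ⟨ha, lt_min ha₁ ha₂⟩
  have hs := cell_sum (f₁ := f₁) (f₂ := f₂) (t := a) (by linarith)
  have hB0 : scoreSlope f₁ f₂ a / (f₁ + f₂ - a) ≠ 0 :=
    (div_pos (scoreSlope_pos ha ha₁ ha₂) (by linarith)).ne'
  have h := isBigO_trinomialExp hp.le hq.le hr.le (b := fun k => 1 / (k : ℝ))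
    (mle_error_expansion ha ha₁ ha₂ hA rfl rfl).1 (fun n => sq_nonneg _) (fun k => by positivity)
    (exists_trinomialExp_totalDev_sq_le hp.le hq.le hr.le hs)
  set B := scoreSlope f₁ f₂ a / (f₁ + f₂ - a)
  refine ((h.const_mul_left B⁻¹).congr' ?_ EventuallyEq.rfl)
  filter_upwards [eventually_gt_atTop 0] with k hk
  have hu := trinomialExp_devForm (α := (f₁ + f₂) / a) (β := -(f₂ / (f₁ - a)))
    (γ := -(f₁ / (f₂ - a))) hp.le hq.le hr.le hs hk
  have hfun : (fun n => B * (A n - a) - devForm (cellEq f₁ f₂ a) (cellLt f₁ f₂ a)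
      (cellGt f₁ f₂ a) ((f₁ + f₂) / a) (-(f₂ / (f₁ - a))) (-(f₁ / (f₂ - a))) n) = fun n =>
      B * (A n - a) + -1 * devForm (cellEq f₁ f₂ a) (cellLt f₁ f₂ a)
      (cellGt f₁ f₂ a) ((f₁ + f₂) / a) (-(f₂ / (f₁ - a))) (-(f₁ / (f₂ - a))) n := by
    funext n
    ring
  rw [hfun, trinomialExp_add, trinomialExp_mul_left, trinomialExp_mul_left, hu]
  field_simp
  ring

lemma trinomialExp_mle_error_sq (ha : 0 < a) (ha₁ : a < f₁) (ha₂ : a < f₂) {A : ℕ × ℕ × ℕ → ℝ}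
    (hA : ∀ n, 0 < trials n → IsMLE f₁ f₂ n.1 n.2.1 n.2.2 (A n)) :
    (fun k => trinomialExp (cellEq f₁ f₂ a) (cellLt f₁ f₂ a) (cellGt f₁ f₂ a) k
      (fun n => (A n - a) ^ 2) - 1 / (k : ℝ) * ((f₁ + f₂ - a) ^ 2 / scoreSlope f₁ f₂ a))
      =O[atTop] fun k : ℕ => 1 / (k : ℝ) ^ 2 := by
  obtain ⟨hp, hq, hr⟩ := cell_pos ⟨ha, lt_min ha₁ ha₂⟩
  have hs := cell_sum (f₁ := f₁) (f₂ := f₂) (t := a) (by linarith)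
  have hJ := (scoreSlope_pos ha ha₁ ha₂).ne'
  have hF : f₁ + f₂ - a ≠ 0 := by linarith
  have hvar : cellEq f₁ f₂ a * ((f₁ + f₂) / a) ^ 2 + cellLt f₁ f₂ a * (-(f₂ / (f₁ - a))) ^ 2 +
      cellGt f₁ f₂ a * (-(f₁ / (f₂ - a))) ^ 2 - (cellEq f₁ f₂ a * ((f₁ + f₂) / a) +
      cellLt f₁ f₂ a * (-(f₂ / (f₁ - a))) + cellGt f₁ f₂ a * (-(f₁ / (f₂ - a)))) ^ 2 =
      scoreSlope f₁ f₂ a := by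
    have h0 : cellEq f₁ f₂ a * ((f₁ + f₂) / a) + cellLt f₁ f₂ a * (-(f₂ / (f₁ - a))) +
        cellGt f₁ f₂ a * (-(f₁ / (f₂ - a))) = 0 := by
      linear_combination cell_score_eq_zero ha ha₁ ha₂
    rw [cell_score_sq ha ha₁ ha₂, h0]
    ring
  obtain ⟨u, hu⟩ : ∃ u, u = devForm (cellEq f₁ f₂ a) (cellLt f₁ f₂ a) (cellGt f₁ f₂ a)
        ((f₁ + f₂) / a) (-(f₂ / (f₁ - a))) (-(f₁ / (f₂ - a))) := ⟨_, rfl⟩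
  obtain ⟨B, hB⟩ : ∃ B, B = scoreSlope f₁ f₂ a / (f₁ + f₂ - a) := ⟨_, rfl⟩
  have hB0 : B ≠ 0 := hB ▸ div_ne_zero hJ hF
  obtain ⟨-, α, β, γ, c, d, hexp⟩ := mle_error_expansion ha ha₁ ha₂ hA hB hu
  have h4 := isBigO_trinomialExp hp.le hq.le hr.le (b := fun k => 1 / (k : ℝ) ^ 2)
    hexp (fun n => pow_nonneg (totalDev_nonneg _ _ _ _) _) (fun k => by positivity)
    (exists_trinomialExp_totalDev_fourth_le hp.le hq.le hr.le hs)
  obtain ⟨C₁, hC₁⟩ := exists_abs_trinomialExp_devForm_sq_mul_le hp.le hq.le hr.le hs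
    ((f₁ + f₂) / a) (-(f₂ / (f₁ - a))) (-(f₁ / (f₂ - a))) α β γ
  obtain ⟨C₂, hC₂⟩ := exists_abs_trinomialExp_devForm_cube_le hp.le hq.le hr.le hs
    ((f₁ + f₂) / a) (-(f₂ / (f₁ - a))) (-(f₁ / (f₂ - a)))
  have o1 := isBigO_of_forall_pos_abs_le hC₁ fun k => by positivity
  have o2 := isBigO_of_forall_pos_abs_le hC₂ fun k => by positivity
  refine ((((h4.add (o1.const_mul_left c)).add (o2.const_mul_left d)).const_mul_left
    (B ^ 2)⁻¹).congr' ?_ EventuallyEq.rfl)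
  filter_upwards [eventually_gt_atTop 0] with k hk
  have hk' : (k : ℝ) ≠ 0 := by exact_mod_cast hk.ne'
  have hsq := trinomialExp_devForm_sq (α := (f₁ + f₂) / a) (β := -(f₂ / (f₁ - a)))
    (γ := -(f₁ / (f₂ - a))) hp.le hq.le hr.le hs hk
  rw [hvar] at hsq
  simp only [← hu] at hsq ⊢
  have hfun : (fun n => B ^ 2 * (A n - a) ^ 2 - u n ^ 2 - c * (u n ^ 2 *
      devForm (cellEq f₁ f₂ a) (cellLt f₁ f₂ a) (cellGt f₁ f₂ a) α β γ n) - d * u n ^ 3) =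
      fun n => B ^ 2 * (A n - a) ^ 2 + (-1 * u n ^ 2 + (-c * (u n ^ 2 *
      devForm (cellEq f₁ f₂ a) (cellLt f₁ f₂ a) (cellGt f₁ f₂ a) α β γ n) + -d * u n ^ 3)) := by
    funext n
    ring
  rw [hfun, trinomialExp_add, trinomialExp_add, trinomialExp_add, trinomialExp_mul_left,
    trinomialExp_mul_left, trinomialExp_mul_left, trinomialExp_mul_left, hsq]
  -- The variance of u is rewritten as B² times the claimed leading term, so that dividing the
  -- expansion by B² isolates it.
  have hBJ : (k : ℝ)⁻¹ * scoreSlope f₁ f₂ a =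
      B ^ 2 * (1 / (k : ℝ) * ((f₁ + f₂ - a) ^ 2 / scoreSlope f₁ f₂ a)) := by
    rw [hB]
    field_simp
  rw [hBJ]
  field_simp
  ring

end Asymptotics

theorem lemma2 {D : ℕ} (S₁ S₂ : Finset (Fin D)) (f₁ f₂ a : ℝ)
    (hf₁ : f₁ = (S₁.card : ℝ)) (hf₂ : f₂ = (S₂.card : ℝ)) (ha : a = ((S₁ ∩ S₂).card : ℝ))
    (ha_pos : 0 < a) (ha_lt₁ : a < f₁) (ha_lt₂ : a < f₂)
    -- independent, uniformly distributed random permutations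
    {Ω : Type*} [MeasurableSpace Ω] (μ : Measure Ω) [IsProbabilityMeasure μ]
    (π : ℕ → Ω → Equiv.Perm (Fin D))
    (hπ_meas : ∀ j σ, MeasurableSet {ω | π j ω = σ})
    (hπ_unif : ∀ j σ, μ.real {ω | π j ω = σ} = 1 / (D ! : ℝ))
    (hπ_indep : iIndepFun (m := fun _ => (⊤ : MeasurableSpace (Equiv.Perm (Fin D)))) π μ)
    -- the maximum likelihood estimator, as a function of the three counts
    (aMLE : ℕ → ℕ → ℕ → ℝ)
    (haMLE : ∀ kEq kLt kGt : ℕ, 0 < kEq + kLt + kGt →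
      IsMLE f₁ f₂ kEq kLt kGt (aMLE kEq kLt kGt)) :
    -- the counts follow the 3-cell multinomial distribution
    (∀ kEq kLt kGt : ℕ,
      μ.real {ω | countEq S₁ S₂ (kEq + kLt + kGt) (fun j => π j ω) = kEq ∧
                  countLt S₁ S₂ (kEq + kLt + kGt) (fun j => π j ω) = kLt ∧
                  countGt S₁ S₂ (kEq + kLt + kGt) (fun j => π j ω) = kGt}
        = likelihood f₁ f₂ kEq kLt kGt a) ∧
    -- the maximum likelihood estimate exists and is unique
    (∀ kEq kLt kGt : ℕ, 0 < kEq + kLt + kGt → ∃! t, IsMLE f₁ f₂ kEq kLt kGt t) ∧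
    -- inside the parameter range it is exactly the solution of the likelihood equation
    (∀ kEq kLt kGt : ℕ, 0 < kEq + kLt + kGt → ∀ t ∈ Set.Ioo 0 (min f₁ f₂),
      (IsMLE f₁ f₂ kEq kLt kGt t ↔ MLEEquation f₁ f₂ kEq kLt kGt t)) ∧
    -- if no cell is empty, the equation has exactly one solution, and this is the estimate
    (∀ kEq kLt kGt : ℕ, 0 < kEq → 0 < kLt → 0 < kGt →
      ∀ t, (t ∈ Set.Ioo 0 (min f₁ f₂) ∧ MLEEquation f₁ f₂ kEq kLt kGt t) ↔
        t = aMLE kEq kLt kGt) ∧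
    -- no cell is empty, with probability tending to one
    Tendsto (fun k : ℕ => μ.real {ω | 0 < countEq S₁ S₂ k (fun j => π j ω) ∧
        0 < countLt S₁ S₂ k (fun j => π j ω) ∧ 0 < countGt S₁ S₂ k (fun j => π j ω)})
      atTop (𝓝 1) ∧
    -- mean and variance are genuine
    (∀ k : ℕ, 0 < k → MemLp (fun ω => aMLE (countEq S₁ S₂ k (fun j => π j ω))
        (countLt S₁ S₂ k (fun j => π j ω)) (countGt S₁ S₂ k (fun j => π j ω))) 2 μ) ∧
    -- asymptotic unbiasedness
    Tendsto (fun k : ℕ => ∫ ω, aMLE (countEq S₁ S₂ k (fun j => π j ω))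
        (countLt S₁ S₂ k (fun j => π j ω)) (countGt S₁ S₂ k (fun j => π j ω)) ∂μ)
      atTop (𝓝 a) ∧
    -- the variance
    (fun k : ℕ =>
        variance (fun ω => aMLE (countEq S₁ S₂ k (fun j => π j ω))
          (countLt S₁ S₂ k (fun j => π j ω)) (countGt S₁ S₂ k (fun j => π j ω))) μ
        - 1 / (k : ℝ) * ((f₁ + f₂ - a) ^ 2 /
            ((f₁ + f₂) / a + f₂ / (f₁ - a) + f₁ / (f₂ - a))))
      =O[atTop] (fun k : ℕ => 1 / (k : ℝ) ^ 2) := by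
  have hf₁0 : 0 < f₁ := ha_pos.trans ha_lt₁
  have hf₂0 : 0 < f₂ := ha_pos.trans ha_lt₂
  have hne : (S₁ ∪ S₂).Nonempty := by
    have : 0 < S₁.card := by exact_mod_cast hf₁ ▸ hf₁0
    exact (Finset.card_pos.1 this).mono Finset.subset_union_left
  obtain ⟨hp, hq, hr⟩ := cell_pos ⟨ha_pos, lt_min ha_lt₁ ha_lt₂⟩
  have hs := cell_sum (f₁ := f₁) (f₂ := f₂) (t := a) (by linarith)
  obtain ⟨A, hAdef⟩ : ∃ A : ℕ × ℕ × ℕ → ℝ, A = fun n => aMLE n.1 n.2.1 n.2.2 := ⟨_, rfl⟩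
  have hA : ∀ n, 0 < trials n → IsMLE f₁ f₂ n.1 n.2.1 n.2.2 (A n) := fun n hn =>
    hAdef ▸ haMLE n.1 n.2.1 n.2.2 hn
  have hAcounts : ∀ k, (fun ω => aMLE (countEq S₁ S₂ k (fun j => π j ω))
      (countLt S₁ S₂ k (fun j => π j ω)) (countGt S₁ S₂ k (fun j => π j ω))) =
      fun ω => A (hashCounts S₁ S₂ k (fun j => π j ω)) := fun k => by
    rw [hAdef]
    rfl
  have hexp := integral_hashCounts_eq_trinomialExp hne hf₁ hf₂ ha hπ_meas hπ_unif hπ_indep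
  have hprob := measure_hashCounts hne hf₁ hf₂ ha hπ_meas hπ_unif hπ_indep
  have hint := integrable_comp_hashCounts (μ := μ) hne hπ_meas
  have hmean : ∀ k, ∫ ω, A (hashCounts S₁ S₂ k (fun j => π j ω)) ∂μ - a =
      trinomialExp (cellEq f₁ f₂ a) (cellLt f₁ f₂ a) (cellGt f₁ f₂ a) k (fun n => A n - a) :=
    fun k => by
      rw [← hexp, integral_sub (hint k A) (integrable_const a)]
      simp
  have hbias := trinomialExp_mle_error ha_pos ha_lt₁ ha_lt₂ hA
  refine ⟨fun kEq kLt kGt => ?_, fun kEq kLt kGt hk => ?_, fun kEq kLt kGt hk t ht =>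
    ⟨fun h => h.mleEquation ht, isMLE_of_mleEquation ht⟩, fun kEq kLt kGt hE hL hG t => ?_,
    ?_, fun k _ => ?_, ?_, ?_⟩
  · have := hprob (kEq + kLt + kGt) fun n => n = (kEq, kLt, kGt)
    rw [trinomialExp_indicator] at this
    rw [likelihood, ← this]
    simp only [hashCounts, Prod.mk.injEq]
  · obtain ⟨t, ht⟩ := exists_isMLE hf₁0 hf₂0 kEq kLt kGt
    exact ⟨t, ht, fun u hu => hu.unique hf₁0 hf₂0 hk ht⟩
  · have hk : 0 < kEq + kLt + kGt := by omega
    have hM := haMLE kEq kLt kGt hk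
    refine ⟨fun h => (isMLE_of_mleEquation h.1 h.2).unique hf₁0 hf₂0 hk hM, ?_⟩
    rintro rfl
    have hmem := hM.mem_Ioo hf₁0 hf₂0 hE hL hG
    exact ⟨hmem, hM.mleEquation hmem⟩
  · refine (trinomialExp_all_cells_pos_tendsto hp hq hr hs).congr fun k => ?_
    exact (hprob k fun n => 0 < n.1 ∧ 0 < n.2.1 ∧ 0 < n.2.2).symm
  · rw [hAcounts]
    exact memLp_comp_hashCounts hne hπ_meas k A 2
  · simp only [hAcounts]
    rw [← tendsto_sub_nhds_zero_iff]
    simp only [hmean]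
    exact hbias.trans_tendsto tendsto_one_div_atTop_nhds_zero_nat
  · simp only [hAcounts]
    have hsq := trinomialExp_mle_error_sq ha_pos ha_lt₁ ha_lt₂ hA
    -- The variance is unchanged by the shift by a, so it equals the mean square error minus the
    -- squared bias, and the latter is O(1/k²).
    have hbias2 := hbias.pow 2
    simp only [one_div, inv_pow] at hbias2 hsq ⊢
    refine (hsq.sub hbias2).congr_left fun k => ?_
    have hL := memLp_comp_hashCounts (μ := μ) hne hπ_meas k A 2
    have hL' := memLp_comp_hashCounts (μ := μ) hne hπ_meas k (fun n => A n - a) 2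
    rw [← variance_sub_const hL.aestronglyMeasurable a, variance_eq_sub hL']
    simp only [Pi.pow_apply]
    rw [hexp k fun n => A n - a, hexp k fun n => (A n - a) ^ 2]
    unfold scoreSlope
    ring
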